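/- Let $\mathcal C_9$ be the Clifford algebra of $\mathbb R^9$ with the relation $v\cdot w+w\cdot v=-2\langle v,w\rangle$, let $\mathrm{Spin}(9)\subset\mathcal C_9$ be the spin group, acting on $\mathbb R^9$ by $v\mapsto gvg^{-1}$, and let $\Delta_9\cong\mathbb R^{16}$ be its real spin representation. Let $v\star\psi$ denote the real Clifford multiplication on $\Delta_9$: the vectors $I_1,\dots,I_9$ of an orthonormal basis of $\mathbb R^9$ act on $\Delta_9$ as symmetric involutions with $I_\alpha I_\beta=-I_\beta I_\alpha$ for $\alpha\neq\beta$, and the product $v\cdot w\in\mathcal C_9$ of two vectors acts on $\Delta_9$ by $\psi\mapsto -\,v\star(w\star\psi)$. For $r\ge 1$ let $$P_r=\ker\Big(\Theta_r^*:\Lambda^r(\mathbb R^9)\otimes\Delta_9\to\Lambda^{r-1}(\mathbb R^9)\otimes\Delta_9\Big),\qquad \Theta_r^*(\omega\otimes\varphi)=-\sum_{\alpha=1}^{9}(I_\alpha\lrcorner\,\omega)\otimes(I_\alpha\star\varphi).$$ Then there are isomorphisms of real $\mathrm{Spin}(9)$-representations $$\Lambda^2(\Delta_9)\cong\Lambda^2(\mathbb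 R^9)\oplus\Lambda^3(\mathbb R^9),\qquad \Lambda^3(\Delta_9)\cong P_1\oplus P_2,$$ and each of the four representations $\Lambda^2(\mathbb R^9)$, $\Lambda^3(\mathbb R^9)$, $P_1$, $P_2$ is irreducible (over $\mathbb R$). -/

import Mathlib

open scoped TensorProduct Kronecker

noncomputable section

namespace Spin9Rep

/-! ### Euclidean 9-space, the Clifford algebra `C₉` and the group `Spin(9)` -/

/-- The Euclidean space `ℝ⁹`. -/
abbrev V9 : Type := EuclideanSpace ℝ (Fin 9)

/-- The standard orthonormal basis of `ℝ⁹`. -/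
def e (a : Fin 9) : V9 := EuclideanSpace.single a 1

/-- The negative definite form `v ↦ -⟨v, v⟩` on `ℝ⁹`; its Clifford algebra has the relation
`v · w + w · v = -2 ⟨v, w⟩`. -/
def Q9 : QuadraticForm ℝ V9 := -LinearMap.BilinMap.toQuadraticMap (innerₗ V9)

lemma Q9_apply (v : V9) : Q9 v = -∑ a, v a * v a := by
  have h : Q9 v = -inner ℝ v v := rfl
  rw [h, PiLp.inner_apply]
  simp [sq]

lemma Q9_eq_zero {v : V9} (h : Q9 v = 0) : v = 0 := by
  have h : -inner ℝ v v = 0 := h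
  exact inner_self_eq_zero.mp (neg_eq_zero.mp h)

/-- The group `Spin(9)` (the even products of unit vectors in the Clifford algebra). -/
abbrev Spin9 : Type := spinGroup Q9

/-! ### The vector representation of `Spin(9)` on `ℝ⁹` -/

lemma algebraMap_Q9_injective : Function.Injective (algebraMap ℝ (CliffordAlgebra Q9)) :=
  FaithfulSMul.algebraMap_injective ℝ _

lemma ι_injective : Function.Injective (CliffordAlgebra.ι Q9) := by
  rw [← LinearMap.ker_eq_bot, LinearMap.ker_eq_bot']
  intro v hv
  apply Q9_eq_zero
  apply algebraMap_Q9_injective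
  rw [← CliffordAlgebra.ι_sq_scalar, hv, mul_zero, map_zero]

lemma conj_mem (g : Spin9) (v : V9) :
    (g : CliffordAlgebra Q9) * CliffordAlgebra.ι Q9 v * star (g : CliffordAlgebra Q9) ∈
      LinearMap.range (CliffordAlgebra.ι Q9) := by
  have h := spinGroup.conjAct_smul_ι_mem_range_ι (Q := Q9) (x := spinGroup.toUnits g) g.2 v
  rwa [ConjAct.units_smul_def, ConjAct.ofConjAct_toConjAct] at h

/-- The linear map `v ↦ g v g⁻¹` of `ℝ⁹`, for `g ∈ Spin(9)` (where `g⁻¹ = star g`). -/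
def vectorMap (g : Spin9) : V9 →ₗ[ℝ] V9 :=
  (LinearEquiv.ofInjective (CliffordAlgebra.ι Q9) ι_injective).symm.toLinearMap ∘ₗ
    LinearMap.codRestrict (LinearMap.range (CliffordAlgebra.ι Q9))
      (LinearMap.mulRight ℝ (star (g : CliffordAlgebra Q9)) ∘ₗ
        LinearMap.mulLeft ℝ (g : CliffordAlgebra Q9) ∘ₗ CliffordAlgebra.ι Q9)
      (conj_mem g)

lemma ι_vectorMap (g : Spin9) (v : V9) :
    CliffordAlgebra.ι Q9 (vectorMap g v) =
      (g : CliffordAlgebra Q9) * CliffordAlgebra.ι Q9 v * star (g : CliffordAlgebra Q9) := by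
  have h := LinearEquiv.apply_symm_apply
    (LinearEquiv.ofInjective (CliffordAlgebra.ι Q9) ι_injective) ⟨_, conj_mem g v⟩
  exact congrArg Subtype.val h

/-- The representation of `Spin(9)` on `ℝ⁹` through the double cover `Spin(9) → SO(9)`. -/
def vectorRep : Representation ℝ Spin9 V9 where
  toFun := vectorMap
  map_one' := by
    apply LinearMap.ext
    intro x
    apply ι_injective
    simp [ι_vectorMap]
  map_mul' g h := by
    apply LinearMap.ext
    intro x
    apply ι_injective
    simp [ι_vectorMap, mul_assoc]

/-! ### Real spinors -/

/-- The index set of the standard basis of `(ℝ²)^{⊗ 4} = ℝ¹⁶`. -/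
abbrev SpinorIndex : Type := Fin 2 × Fin 2 × Fin 2 × Fin 2

/-- The 16-dimensional Euclidean space `Δ₉` of real spinors. -/
abbrev Delta9 : Type := EuclideanSpace ℝ SpinorIndex

/-- A symmetric involution of `ℝ²`. -/
def σX : Matrix (Fin 2) (Fin 2) ℝ := !![0, 1; 1, 0]
/-- A symmetric involution of `ℝ²`. -/
def σZ : Matrix (Fin 2) (Fin 2) ℝ := !![1, 0; 0, -1]
/-- An antisymmetric complex structure of `ℝ²`. -/
def σE : Matrix (Fin 2) (Fin 2) ℝ := !![0, -1; 1, 0]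

/-- The symmetric involutions `I₁, …, I₉` of `Δ₉`, which anticommute pairwise
(see `I_mul_self`, `I_transpose`, `I_anticomm`). On the complexification
`Δ₉ ⊗ ℂ` (the complex spinors), the Clifford multiplication by the `α`-th basis vector is `-i I_α`,
and complex conjugation is the real structure, which anticommutes with it. -/
def I : Fin 9 → Matrix SpinorIndex SpinorIndex ℝ :=
  ![σE ⊗ₖ (σE ⊗ₖ (σX ⊗ₖ (1 : Matrix (Fin 2) (Fin 2) ℝ))),
    σE ⊗ₖ (σE ⊗ₖ (σZ ⊗ₖ (1 : Matrix (Fin 2) (Fin 2) ℝ))),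
    σE ⊗ₖ (σX ⊗ₖ ((1 : Matrix (Fin 2) (Fin 2) ℝ) ⊗ₖ σE)),
    σE ⊗ₖ (σZ ⊗ₖ ((1 : Matrix (Fin 2) (Fin 2) ℝ) ⊗ₖ σE)),
    σE ⊗ₖ ((1 : Matrix (Fin 2) (Fin 2) ℝ) ⊗ₖ (σE ⊗ₖ σX)),
    σE ⊗ₖ ((1 : Matrix (Fin 2) (Fin 2) ℝ) ⊗ₖ (σE ⊗ₖ σZ)),
    σE ⊗ₖ (σE ⊗ₖ (σE ⊗ₖ σE)),
    σX ⊗ₖ ((1 : Matrix (Fin 2) (Fin 2) ℝ) ⊗ₖ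
      ((1 : Matrix (Fin 2) (Fin 2) ℝ) ⊗ₖ (1 : Matrix (Fin 2) (Fin 2) ℝ))),
    σZ ⊗ₖ ((1 : Matrix (Fin 2) (Fin 2) ℝ) ⊗ₖ
      ((1 : Matrix (Fin 2) (Fin 2) ℝ) ⊗ₖ (1 : Matrix (Fin 2) (Fin 2) ℝ)))]

lemma σX_mul_σX : σX * σX = 1 := by
  ext i j; fin_cases i <;> fin_cases j <;> simp [σX]
lemma σZ_mul_σZ : σZ * σZ = 1 := by
  ext i j; fin_cases i <;> fin_cases j <;> simp [σZ]
lemma σE_mul_σE : σE * σE = -1 := by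
  ext i j; fin_cases i <;> fin_cases j <;> simp [σE]
lemma σZ_mul_σX : σZ * σX = -(σX * σZ) := by
  ext i j; fin_cases i <;> fin_cases j <;> simp [σX, σZ]
lemma σE_mul_σX : σE * σX = -(σX * σE) := by
  ext i j; fin_cases i <;> fin_cases j <;> simp [σX, σE]
lemma σE_mul_σZ : σE * σZ = -(σZ * σE) := by
  ext i j; fin_cases i <;> fin_cases j <;> simp [σZ, σE]
lemma σX_transpose : σX.transpose = σX := by
  ext i j; fin_cases i <;> fin_cases j <;> simp [σX]
lemma σZ_transpose : σZ.transpose = σZ := by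
  ext i j; fin_cases i <;> fin_cases j <;> simp [σZ]
lemma σE_transpose : σE.transpose = -σE := by
  ext i j; fin_cases i <;> fin_cases j <;> simp [σE]

lemma neg_kron {l m n p : Type*} (A : Matrix l m ℝ) (B : Matrix n p ℝ) :
    (-A) ⊗ₖ B = -(A ⊗ₖ B) := by
  ext i j; simp [Matrix.kroneckerMap_apply]
lemma kron_neg {l m n p : Type*} (A : Matrix l m ℝ) (B : Matrix n p ℝ) :
    A ⊗ₖ (-B) = -(A ⊗ₖ B) := by
  ext i j; simp [Matrix.kroneckerMap_apply]

lemma I_mul_self (a : Fin 9) : I a * I a = 1 := by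
  fin_cases a <;>
    simp [I, ← Matrix.mul_kronecker_mul, σX_mul_σX, σZ_mul_σZ, σE_mul_σE, neg_kron, kron_neg]

lemma I_transpose (a : Fin 9) : (I a).transpose = I a := by
  fin_cases a <;>
    simp [I, ← Matrix.kroneckerMap_transpose, σX_transpose, σZ_transpose, σE_transpose, neg_kron,
      kron_neg]

set_option maxHeartbeats 1000000 in
lemma I_anticomm_of_lt (a b : Fin 9) (h : a < b) : I a * I b = -(I b * I a) := by
  fin_cases a <;> fin_cases b <;> first
    | exact absurd h (by decide)
    | simp [I, ← Matrix.mul_kronecker_mul, σE_mul_σE, σZ_mul_σX, σE_mul_σX, σE_mul_σZ, neg_kron, kron_neg]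

lemma I_anticomm (a b : Fin 9) (h : a ≠ b) : I a * I b = -(I b * I a) := by
  rcases lt_or_gt_of_ne h with h | h
  · exact I_anticomm_of_lt a b h
  · rw [I_anticomm_of_lt b a h, neg_neg]

/-- The real Clifford multiplication `v ⋆ ψ` of spinors by vectors. -/
def starMul : V9 →ₗ[ℝ] Module.End ℝ Delta9 where
  toFun v := ∑ a, v a • Matrix.toEuclideanLin (I a)
  map_add' v w := by simp [add_smul, Finset.sum_add_distrib]
  map_smul' c v := by simp [Finset.smul_sum, smul_smul]

lemma starMul_apply (v : V9) : starMul v = ∑ a, v a • Matrix.toEuclideanLin (I a) := rfl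

lemma starMul_mul_self (v : V9) :
    starMul v * starMul v = algebraMap ℝ (Module.End ℝ Delta9) (∑ a, v a * v a) := by
  have key : ∀ a b, Matrix.toEuclideanLin (I a) * Matrix.toEuclideanLin (I b) + Matrix.toEuclideanLin (I b) *
      Matrix.toEuclideanLin (I a) = if a = b then (2 : Module.End ℝ Delta9) else 0 := by
    intro a b
    simp only [Module.End.mul_eq_comp, ← Matrix.toLpLin_mul_same]
    split_ifs with h
    · subst h
      rw [I_mul_self, Matrix.toLpLin_one]
      exact one_add_one_eq_two
    · rw [I_anticomm a b h, map_neg, neg_add_cancel]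
  have h2 : (2 : ℝ) • (starMul v * starMul v) =
      (2 : ℝ) • algebraMap ℝ (Module.End ℝ Delta9) (∑ a, v a * v a) := by
    have e1 : starMul v * starMul v =
        ∑ a, ∑ b, (v a * v b) • (Matrix.toEuclideanLin (I a) * Matrix.toEuclideanLin (I b)) := by
      simp only [starMul_apply, Finset.sum_mul_sum, smul_mul_smul_comm]
    have e2 : starMul v * starMul v =
        ∑ a, ∑ b, (v a * v b) • (Matrix.toEuclideanLin (I b) * Matrix.toEuclideanLin (I a)) := by
      rw [e1, Finset.sum_comm]
      simp only [mul_comm]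
    rw [two_smul]
    nth_rewrite 1 [e1]
    rw [e2]
    simp only [← Finset.sum_add_distrib, ← smul_add, key]
    simp only [smul_ite, smul_zero, Finset.sum_ite_eq, Finset.mem_univ, if_true]
    rw [← Finset.sum_smul, Algebra.algebraMap_eq_smul_one, smul_smul, mul_comm, mul_smul]
    congr 1
    rw [two_smul]; exact one_add_one_eq_two.symm
  exact smul_right_injective _ (two_ne_zero' ℝ) h2

/-- The even Clifford products `v · w = -(v ⋆ w ⋆ ·)` acting on `Δ₉`. -/
def evenSpinor : CliffordAlgebra.EvenHom Q9 (Module.End ℝ Delta9) where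
  bilin := LinearMap.mk₂ ℝ (fun v w => -(starMul v * starMul w))
    (fun u v w => by simp only [map_add, add_mul, neg_add])
    (fun c v w => by simp only [map_smul, smul_mul_assoc, smul_neg])
    (fun u v w => by simp only [map_add, mul_add, neg_add])
    (fun c v w => by simp only [map_smul, mul_smul_comm, smul_neg])
  contract v := by
    rw [LinearMap.mk₂_apply, starMul_mul_self, Q9_apply, map_neg]
  contract_mid u v w := by
    have h : starMul u * starMul v * (starMul v * starMul w) =
        (∑ a, v a * v a) • (starMul u * starMul w) := by
      rw [mul_assoc, ← mul_assoc (starMul v), starMul_mul_self, ← Algebra.smul_def,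
        mul_smul_comm]
    rw [LinearMap.mk₂_apply, LinearMap.mk₂_apply, LinearMap.mk₂_apply, neg_mul_neg (starMul u * starMul v), h, Q9_apply,
      neg_smul, smul_neg, neg_neg]

/-- The action on `Δ₉` of the even part of the Clifford algebra. -/
def evenAction : CliffordAlgebra.even Q9 →ₐ[ℝ] Module.End ℝ Delta9 :=
  CliffordAlgebra.even.lift Q9 evenSpinor

/-- The spin representation `κ₉` of `Spin(9)` on `Δ₉`. -/
def spinRep : Representation ℝ Spin9 Delta9 where
  toFun g := evenAction ⟨g, spinGroup.mem_even g.2⟩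
  map_one' := map_one evenAction
  map_mul' g h := map_mul evenAction ⟨g, spinGroup.mem_even g.2⟩ ⟨h, spinGroup.mem_even h.2⟩

lemma evenAction_ι_mul_ι (v w : V9) :
    evenAction ((CliffordAlgebra.even.ι Q9).bilin v w) = -(starMul v * starMul w) :=
  CliffordAlgebra.even.lift_ι Q9 evenSpinor v w

/-! The complex Clifford module `Δ₉ ⊗ ℂ = Δ₉ ⊕ i Δ₉`, used to see that `⋆` is equivariant. -/

/-- The map `ψ + i φ ↦ -i (v ⋆ (ψ + i φ))` of `Δ₉ ⊕ i Δ₉`. -/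
def complexMul : V9 →ₗ[ℝ] Module.End ℝ (Delta9 × Delta9) where
  toFun v := ((starMul v) ∘ₗ LinearMap.snd ℝ Delta9 Delta9).prod
    (-((starMul v) ∘ₗ LinearMap.fst ℝ Delta9 Delta9))
  map_add' v w := by
    apply LinearMap.ext
    intro x
    refine Prod.ext ?_ ?_
    · exact LinearMap.congr_fun (map_add starMul v w) x.2
    · exact (congrArg Neg.neg (LinearMap.congr_fun (map_add starMul v w) x.1)).trans
        (neg_add (starMul v x.1) (starMul w x.1))
  map_smul' c v := by
    apply LinearMap.ext
    intro x
    refine Prod.ext ?_ ?_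
    · exact LinearMap.congr_fun (map_smul starMul c v) x.2
    · exact (congrArg Neg.neg (LinearMap.congr_fun (map_smul starMul c v) x.1)).trans
        (smul_neg c (starMul v x.1)).symm

lemma complexMul_apply (v : V9) (x : Delta9 × Delta9) :
    complexMul v x = (starMul v x.2, -starMul v x.1) := rfl

/-- The action of the Clifford algebra on `Δ₉ ⊗ ℂ`. -/
def complexAction : CliffordAlgebra Q9 →ₐ[ℝ] Module.End ℝ (Delta9 × Delta9) :=
  CliffordAlgebra.lift Q9 ⟨complexMul, fun v => by
    apply LinearMap.ext
    intro x
    have h : ∀ y, starMul v (starMul v y) = (∑ a, v a * v a) • y := fun y => by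
      rw [← Module.End.mul_apply, starMul_mul_self, Module.algebraMap_end_apply]
    rw [Module.End.mul_apply, Module.algebraMap_end_apply, complexMul_apply, complexMul_apply,
      map_neg, h, h, Q9_apply, neg_smul]
    rfl⟩

lemma complexAction_ι (v : V9) : complexAction (CliffordAlgebra.ι Q9 v) = complexMul v :=
  CliffordAlgebra.lift_ι_apply _ _ _

lemma complexAction_even (x : CliffordAlgebra.even Q9) :
    ∀ y, complexAction (x : CliffordAlgebra Q9) y = (evenAction x y.1, evenAction x y.2) := by
  suffices h : ∀ (z : CliffordAlgebra Q9) (hz : z ∈ CliffordAlgebra.evenOdd Q9 0),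
      ∀ x : CliffordAlgebra.even Q9, (x : CliffordAlgebra Q9) = z →
        ∀ y, complexAction z y = (evenAction x y.1, evenAction x y.2) from
    h x x.2 x rfl
  intro z hz
  induction z, hz using CliffordAlgebra.even_induction with
  | algebraMap r =>
    intro x hx y
    have h : x = algebraMap ℝ (CliffordAlgebra.even Q9) r := Subtype.ext hx
    rw [h, AlgHom.commutes, AlgHom.commutes]
    rfl
  | add u v hu hv ihu ihv =>
    intro x hx y
    let u' : CliffordAlgebra.even Q9 := ⟨u, hu⟩
    let v' : CliffordAlgebra.even Q9 := ⟨v, hv⟩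
    have h : x = u' + v' := Subtype.ext hx
    rw [h, map_add, map_add, LinearMap.add_apply, ihu u' rfl, ihv v' rfl]
    rfl
  | ι_mul_ι_mul u v w hw ih =>
    intro x hx y
    let w' : CliffordAlgebra.even Q9 := ⟨w, hw⟩
    have h : x = (CliffordAlgebra.even.ι Q9).bilin u v * w' := Subtype.ext hx
    rw [h, map_mul, map_mul, map_mul, evenAction_ι_mul_ι, complexAction_ι, complexAction_ι,
      Module.End.mul_apply, ih w' rfl, Module.End.mul_apply, complexMul_apply, complexMul_apply,
      map_neg]
    rfl

lemma spinRep_starMul (g : Spin9) (v : V9) (ψ : Delta9) :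
    starMul (vectorRep g v) (spinRep g ψ) = spinRep g (starMul v ψ) := by
  have h : complexMul (vectorRep g v) * complexAction (g : CliffordAlgebra Q9) =
      complexAction (g : CliffordAlgebra Q9) * complexMul v := by
    rw [← complexAction_ι, ← complexAction_ι, ← map_mul, ← map_mul]
    congr 1
    change CliffordAlgebra.ι Q9 (vectorMap g v) * _ = _
    rw [ι_vectorMap, mul_assoc, spinGroup.coe_star_mul_self, mul_one]
  have h' := congrArg Prod.fst (LinearMap.congr_fun h ((0 : Delta9), ψ))
  rw [Module.End.mul_apply, Module.End.mul_apply,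
    complexAction_even ⟨g, spinGroup.mem_even g.2⟩,
    complexAction_even ⟨g, spinGroup.mem_even g.2⟩] at h'
  exact h'

/-! ### Exterior powers -/

section ExteriorPower

variable {V : Type} [AddCommGroup V] [Module ℝ V]

/-- The `k`-th exterior power `Λᵏ V`. -/
def Ext (k : ℕ) (V : Type) [AddCommGroup V] [Module ℝ V] : Type := ⋀[ℝ]^k V

instance (k : ℕ) : AddCommGroup (Ext k V) := inferInstanceAs (AddCommGroup (⋀[ℝ]^k V))

instance (k : ℕ) : Module ℝ (Ext k V) := inferInstanceAs (Module ℝ (⋀[ℝ]^k V))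

/-- The map `Λᵏ f : v₁ ∧ ⋯ ∧ v_k ↦ f v₁ ∧ ⋯ ∧ f v_k`. -/
def extMap (k : ℕ) (f : V →ₗ[ℝ] V) : Ext k V →ₗ[ℝ] Ext k V := exteriorPower.map k f

/-- The representation on `Λᵏ V` induced by a representation on `V`. -/
def extRep {G : Type} [Monoid G] (k : ℕ) (ρ : Representation ℝ G V) :
    Representation ℝ G (Ext k V) where
  toFun g := extMap k (ρ g)
  map_one' := by rw [map_one]; exact exteriorPower.map_id
  map_mul' g h := by rw [map_mul]; exact exteriorPower.map_comp _ _

lemma contract_mem (d : Module.Dual ℝ V) (k : ℕ) :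
    ∀ x ∈ ⋀[ℝ]^(k + 1) V,
      CliffordAlgebra.contractLeft (Q := (0 : QuadraticForm ℝ V)) d x ∈ ⋀[ℝ]^k V := by
  induction k with
  | zero =>
    intro x hx
    change x ∈ LinearMap.range (ExteriorAlgebra.ι ℝ) ^ 1 at hx
    rw [pow_one] at hx
    obtain ⟨v, rfl⟩ := hx
    change CliffordAlgebra.contractLeft d (CliffordAlgebra.ι 0 v) ∈
      LinearMap.range (ExteriorAlgebra.ι ℝ) ^ 0
    rw [CliffordAlgebra.contractLeft_ι, pow_zero]
    exact Submodule.algebraMap_mem _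
  | succ k ih =>
    intro x hx
    change x ∈ LinearMap.range (ExteriorAlgebra.ι ℝ) ^ (k + 1 + 1) at hx
    rw [pow_succ'] at hx
    induction hx using Submodule.mul_induction_on' with
    | mem_mul_mem m hm n hn =>
      obtain ⟨v, rfl⟩ := hm
      change CliffordAlgebra.contractLeft d (CliffordAlgebra.ι 0 v * n) ∈ _
      rw [CliffordAlgebra.contractLeft_ι_mul]
      refine Submodule.sub_mem _ (Submodule.smul_mem _ _ hn) ?_
      change _ ∈ LinearMap.range (ExteriorAlgebra.ι ℝ) ^ (k + 1)
      rw [pow_succ']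
      exact Submodule.mul_mem_mul ⟨v, rfl⟩ (ih n hn)
    | add x _ y _ hx hy =>
      rw [map_add]
      exact Submodule.add_mem _ hx hy

/-- The interior product `ω ↦ d ⌟ ω` of a `(k+1)`-form with a covector. -/
def contract (d : Module.Dual ℝ V) (k : ℕ) :
    Ext (k + 1) V →ₗ[ℝ] Ext k V :=
  (CliffordAlgebra.contractLeft (Q := (0 : QuadraticForm ℝ V)) d).restrict (contract_mem d k)

/-- The inclusion of `Λᵏ V` in the exterior algebra. -/
def toExt (k : ℕ) : Ext k V →ₗ[ℝ] ExteriorAlgebra ℝ V := (⋀[ℝ]^k V).subtype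

lemma toExt_injective (k : ℕ) : Function.Injective (toExt (V := V) k) := Subtype.val_injective

lemma contract_coe (d : Module.Dual ℝ V) (k : ℕ) (ω : Ext (k + 1) V) :
    toExt k (contract d k ω) =
      CliffordAlgebra.contractLeft (Q := (0 : QuadraticForm ℝ V)) d (toExt (k + 1) ω) :=
  rfl

lemma extMap_coe (f : V →ₗ[ℝ] V) (k : ℕ) (ω : Ext k V) :
    toExt k (extMap k f ω) = ExteriorAlgebra.map f (toExt k ω) := by
  have h : (⋀[ℝ]^k V).subtype ∘ₗ exteriorPower.map k f =
      (ExteriorAlgebra.map f).toLinearMap ∘ₗ (⋀[ℝ]^k V).subtype := by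
    apply exteriorPower.linearMap_ext
    ext v
    simp [Function.comp_def]
  exact LinearMap.congr_fun h ω

lemma contractLeft_map (d : Module.Dual ℝ V)
    (f : V →ₗ[ℝ] V) (x : ExteriorAlgebra ℝ V) :
    CliffordAlgebra.contractLeft (Q := (0 : QuadraticForm ℝ V)) d (ExteriorAlgebra.map f x) =
      ExteriorAlgebra.map f
        (CliffordAlgebra.contractLeft (Q := (0 : QuadraticForm ℝ V)) (d ∘ₗ f) x) := by
  induction x using CliffordAlgebra.left_induction with
  | algebraMap r =>
    have h : ExteriorAlgebra.map f (algebraMap ℝ _ r) =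
        algebraMap ℝ (CliffordAlgebra (0 : QuadraticForm ℝ V)) r :=
      AlgHom.commutes (ExteriorAlgebra.map f) r
    rw [CliffordAlgebra.contractLeft_algebraMap, map_zero, h,
      CliffordAlgebra.contractLeft_algebraMap]
  | add x y hx hy => rw [map_add, map_add, map_add, map_add, hx, hy]
  | ι_mul x v hx =>
    have h : ExteriorAlgebra.map f (CliffordAlgebra.ι 0 v) = CliffordAlgebra.ι 0 (f v) :=
      ExteriorAlgebra.map_apply_ι f v
    rw [map_mul, h, CliffordAlgebra.contractLeft_ι_mul, CliffordAlgebra.contractLeft_ι_mul, hx,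
      map_sub, map_mul, h, map_smul]
    rfl

lemma contract_map (d : Module.Dual ℝ V) (f : V →ₗ[ℝ] V) (k : ℕ) (ω : Ext (k + 1) V) :
    contract d k (extMap (k + 1) f ω) = extMap k f (contract (d ∘ₗ f) k ω) := by
  apply toExt_injective
  rw [contract_coe, extMap_coe, extMap_coe, contract_coe, contractLeft_map]

lemma contract_sum {ι : Type} [Fintype ι] (c : ι → ℝ) (d : ι → Module.Dual ℝ V) (k : ℕ)
    (ω : Ext (k + 1) V) :
    contract (∑ i, c i • d i) k ω = ∑ i, c i • contract (d i) k ω := by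
  apply toExt_injective
  simp only [contract_coe, map_sum, map_smul, LinearMap.sum_apply, LinearMap.smul_apply]

end ExteriorPower

/-! ### Spinor-valued forms and the representations `P_r` -/

/-- The representation of `Spin(9)` on the spinor-valued `k`-forms `Λᵏ(ℝ⁹) ⊗ Δ₉`. -/
def formRep (k : ℕ) : Representation ℝ Spin9 (Ext k V9 ⊗[ℝ] Delta9) :=
  (extRep k vectorRep).tprod spinRep

/-- The operator `Θ*_{k+1} : Λ^{k+1}(ℝ⁹) ⊗ Δ₉ → Λ^k(ℝ⁹) ⊗ Δ₉`,
`ω ⊗ φ ↦ -∑_α (e_α ⌟ ω) ⊗ (e_α ⋆ φ)`. -/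
def thetaStar (k : ℕ) : Ext (k + 1) V9 ⊗[ℝ] Delta9 →ₗ[ℝ] Ext k V9 ⊗[ℝ] Delta9 :=
  -∑ a : Fin 9, TensorProduct.map (contract (innerₗ V9 (e a)) k) (starMul (e a))

lemma thetaStar_tmul (k : ℕ) (ω : Ext (k + 1) V9) (φ : Delta9) :
    thetaStar k (ω ⊗ₜ φ) =
      -∑ a : Fin 9, contract (innerₗ V9 (e a)) k ω ⊗ₜ[ℝ] starMul (e a) φ := by
  rw [thetaStar, LinearMap.neg_apply, LinearMap.sum_apply]
  rfl

lemma thetaStar_equivariant (k : ℕ) (g : Spin9) (x : Ext (k + 1) V9 ⊗[ℝ] Delta9) :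
    thetaStar k (formRep (k + 1) g x) = formRep k g (thetaStar k x) := by
  induction x using TensorProduct.induction_on with
  | zero => simp only [map_zero]
  | add x y hx hy => simp only [map_add, hx, hy]
  | tmul ω φ =>
    change thetaStar k (extMap (k + 1) (vectorRep g) ω ⊗ₜ spinRep g φ) = _
    rw [thetaStar_tmul, thetaStar_tmul, map_neg, map_sum]
    congr 1
    have h1 : ∀ a : Fin 9, innerₗ V9 (e a) ∘ₗ vectorRep g =
        ∑ b, (vectorRep g (e b) a) • innerₗ V9 (e b) := by
      intro a
      apply (EuclideanSpace.basisFun (Fin 9) ℝ).toBasis.ext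
      intro b
      simp [e, EuclideanSpace.inner_single_left, Finset.sum_apply]
    have h2 : ∀ b : Fin 9, vectorRep g (e b) = ∑ a, vectorRep g (e b) a • e a := by
      intro b
      have h := (EuclideanSpace.basisFun (Fin 9) ℝ).sum_repr (vectorRep g (e b))
      simpa [e] using h.symm
    have h3 : ∀ b : Fin 9, formRep k g
        (contract (innerₗ V9 (e b)) k ω ⊗ₜ[ℝ] starMul (e b) φ) =
        ∑ a, extMap k (vectorRep g) (contract (innerₗ V9 (e b)) k ω) ⊗ₜ[ℝ]
          (vectorRep g (e b) a • starMul (e a) (spinRep g φ)) := by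
      intro b
      change extMap k (vectorRep g) (contract (innerₗ V9 (e b)) k ω) ⊗ₜ[ℝ]
        spinRep g (starMul (e b) φ) = _
      rw [← spinRep_starMul]
      nth_rewrite 1 [h2 b]
      rw [map_sum, LinearMap.sum_apply, TensorProduct.tmul_sum]
      simp only [map_smul, LinearMap.smul_apply]
    simp only [h3]
    rw [Finset.sum_comm]
    refine Finset.sum_congr rfl fun a _ => ?_
    rw [contract_map, h1, contract_sum, map_sum, TensorProduct.sum_tmul]
    refine Finset.sum_congr rfl fun b _ => ?_
    rw [map_smul, TensorProduct.smul_tmul]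

/-- The kernel `P_r` of `Θ*_r` on `Λʳ(ℝ⁹) ⊗ Δ₉`, as a subrepresentation. For `r = 0` the
operator `Θ*_0` has target `Λ^{-1} = 0`, and `P_0` is everything. -/
def P : (r : ℕ) → Subrepresentation (formRep r)
  | 0 => ⊤
  | k + 1 =>
    { toSubmodule := LinearMap.ker (thetaStar k)
      apply_mem_toSubmodule := fun g x hx => by
        rw [LinearMap.mem_ker] at hx ⊢
        rw [thetaStar_equivariant, hx, map_zero] }

end Spin9Rep

end

/-! Each decomposition comes from Schur's lemma and a dimension count: two irreducible
representations of different dimensions, each with a nonzero map into a third whose dimension is at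
most their sum, decompose it (`nonempty_equiv_prod`). The numbers are 120 = 36 + 84 and 560 = 128 +
432, where rank-nullity gives dim P₁ ≥ 144 - 16 and dim P₂ ≥ 576 - 144; equality is not needed
beforehand.

Irreducibility uses only the half turns e_a e_b and the quarter turns (1 + e_a e_b)/√2. On Λᵏ(ℝ⁹)
with 2k < 9 the half turns are diagonal with enough sign patterns to isolate a basis vector, and the
quarter turns permute basis vectors up to sign. For P₁ and P₂, spinor-valued forms are written
through e_a ⊗ (e_a ⋆ ψ) and (e_a ∧ e_b) ⊗ (e_a ⋆ e_b ⋆ ψ). Half turns then act on ψ alone, and their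
linear combinations and products give all of End(Δ₉); a combination of group elements
(`transposition`) permutes the indices and leaves ψ alone. So Λʳ ⊗ Δ₉ becomes the permutation module
of S₉ on r-subsets tensored with Δ₉. In these coordinates Θ* is, up to a factor, the sum over the
points of each subset, and P₁, P₂ correspond to the Specht modules of shape (8,1) and (7,2);
differences and mixed differences generate them.

The nonzero maps come from A ↦ ∑ ε_i ∧ A ε_i, which kills symmetric operators. Products of two or
three orthogonal Clifford multiplications are antisymmetric, so they give maps from 2-forms and
3-forms to bivectors; wedging with a further spinor gives the maps to trivectors. Explicit matrix
entries show that they do not vanish. -/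

open scoped TensorProduct Kronecker

noncomputable section

namespace Spin9Rep

/-! ### Irreducibility criteria and the Schur-type dimension count. -/

section Irreducible

variable {G V W U : Type*} [Monoid G] [AddCommGroup V] [Module ℝ V] [AddCommGroup W] [Module ℝ W]
  [AddCommGroup U] [Module ℝ U]

lemma isIrreducible_of_invariant [Nontrivial V] (ρ : Representation ℝ G V)
    (h : ∀ S : Submodule ℝ V, (∀ g, ∀ x ∈ S, ρ g x ∈ S) → S ≠ ⊥ → S = ⊤) : ρ.IsIrreducible where
  exists_pair_ne := by
    refine ⟨⊥, ⊤, fun hbt => ?_⟩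
    have : (⊥ : Submodule ℝ V) = ⊤ := congrArg Subrepresentation.toSubmodule hbt
    exact bot_ne_top this
  eq_bot_or_eq_top S := by
    by_cases hS : S.toSubmodule = ⊥
    · exact Or.inl (Subrepresentation.toSubmodule_injective hS)
    · exact Or.inr (Subrepresentation.toSubmodule_injective
        (h S.toSubmodule (fun g x hx => S.apply_mem_toSubmodule g hx) hS))

lemma toRepresentation_isIrreducible (ρ : Representation ℝ G V) (T : Subrepresentation ρ)
    (hT : T.toSubmodule ≠ ⊥)
    (h : ∀ S : Submodule ℝ V, (∀ g, ∀ x ∈ S, ρ g x ∈ S) → S ≤ T.toSubmodule → S ≠ ⊥ →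
      T.toSubmodule ≤ S) : T.toRepresentation.IsIrreducible := by
  have : Nontrivial T.toSubmodule := Submodule.nontrivial_iff_ne_bot.mpr hT
  refine isIrreducible_of_invariant _ fun S hS hne => ?_
  have hle := h (S.map T.toSubmodule.subtype) ?_ (Submodule.map_subtype_le _ _) ?_
  · rw [eq_top_iff]
    intro x _
    obtain ⟨y, hy, hyx⟩ := hle x.2
    rwa [← Subtype.ext hyx]
  · rintro g _ ⟨x, hx, rfl⟩
    exact ⟨_, hS g x hx, rfl⟩
  · intro h0
    exact hne (Submodule.map_injective_of_injective T.toSubmodule.injective_subtype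
      (h0.trans (Submodule.map_bot _).symm))

/-- Two irreducible representations of different dimension with nonzero intertwining maps into a
representation whose dimension is at most the sum of theirs decompose that representation. -/
lemma nonempty_equiv_prod [FiniteDimensional ℝ V] [FiniteDimensional ℝ W] [FiniteDimensional ℝ U]
    {ρ : Representation ℝ G V} {σ : Representation ℝ G W} {τ : Representation ℝ G U}
    [ρ.IsIrreducible] [σ.IsIrreducible]
    (f : ρ.IntertwiningMap τ) (g : σ.IntertwiningMap τ) (hf : ∃ x, f x ≠ 0) (hg : ∃ x, g x ≠ 0)
    (hne : Module.finrank ℝ V ≠ Module.finrank ℝ W)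
    (hle : Module.finrank ℝ U ≤ Module.finrank ℝ V + Module.finrank ℝ W) :
    Nonempty (τ.Equiv (ρ.prod σ)) := by
  have hf' : Function.Injective f := by
    refine (Representation.IsIrreducible.injective_or_eq_zero f).resolve_right ?_
    rintro rfl
    obtain ⟨x, hx⟩ := hf
    exact hx rfl
  have hg' : Function.Injective g := by
    refine (Representation.IsIrreducible.injective_or_eq_zero g).resolve_right ?_
    rintro rfl
    obtain ⟨x, hx⟩ := hg
    exact hx rfl
  have fr : Module.finrank ℝ (LinearMap.range f.toLinearMap) = Module.finrank ℝ V :=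
    LinearMap.finrank_range_of_inj hf'
  have gr : Module.finrank ℝ (LinearMap.range g.toLinearMap) = Module.finrank ℝ W :=
    LinearMap.finrank_range_of_inj hg'
  -- The preimage of each range under the other map is a subrepresentation. A common nonzero vector
  -- makes both preimages everything, so the ranges coincide, against the unequal dimensions.
  have key : ∀ x y, f x + g y = 0 → x = 0 ∧ y = 0 := by
    by_contra hcon
    push Not at hcon
    obtain ⟨x, y, hxy, h0⟩ := hcon
    have hfg : f x = g (-y) := by rw [map_neg]; exact eq_neg_of_add_eq_zero_left hxy
    have hx : x ≠ 0 := by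
      rintro rfl
      refine h0 rfl (hg' ?_)
      rw [map_zero, ← hxy, map_zero, zero_add]
    have hy : -y ≠ 0 := by
      intro hy
      rw [hy, map_zero] at hfg
      exact hx (hf' (hfg.trans (map_zero f).symm))
    let A : Subrepresentation ρ :=
      { toSubmodule := (LinearMap.range g.toLinearMap).comap f.toLinearMap
        apply_mem_toSubmodule := by
          rintro s v ⟨w, hw⟩
          refine ⟨σ s w, ?_⟩
          change g (σ s w) = f (ρ s v)
          rw [f.isIntertwining, g.isIntertwining]
          exact congrArg _ hw }
    let B : Subrepresentation σ :=
      { toSubmodule := (LinearMap.range f.toLinearMap).comap g.toLinearMap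
        apply_mem_toSubmodule := by
          rintro s v ⟨w, hw⟩
          refine ⟨ρ s w, ?_⟩
          change f (ρ s w) = g (σ s v)
          rw [f.isIntertwining, g.isIntertwining]
          exact congrArg _ hw }
    have hA : A = ⊤ := (eq_bot_or_eq_top A).resolve_left fun hA => by
      have : x ∈ A.toSubmodule := ⟨-y, hfg.symm⟩
      rw [hA] at this
      exact hx this
    have hB : B = ⊤ := (eq_bot_or_eq_top B).resolve_left fun hB => by
      have : -y ∈ B.toSubmodule := ⟨x, hfg⟩
      rw [hB] at this
      exact hy this
    have h1 : LinearMap.range f.toLinearMap ≤ LinearMap.range g.toLinearMap := by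
      rintro _ ⟨v, rfl⟩
      have : v ∈ A.toSubmodule := hA ▸ Submodule.mem_top
      exact this
    have h2 : LinearMap.range g.toLinearMap ≤ LinearMap.range f.toLinearMap := by
      rintro _ ⟨v, rfl⟩
      have : v ∈ B.toSubmodule := hB ▸ Submodule.mem_top
      exact this
    rw [← fr, ← gr, le_antisymm h1 h2] at hne
    exact hne rfl
  let F : (V × W) →ₗ[ℝ] U := f.toLinearMap.coprod g.toLinearMap
  have hF : Function.Injective F := by
    rw [← LinearMap.ker_eq_bot, LinearMap.ker_eq_bot']
    intro p hp
    exact Prod.ext (key p.1 p.2 hp).1 (key p.1 p.2 hp).2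
  have hdim : Module.finrank ℝ (V × W) = Module.finrank ℝ U := by
    refine le_antisymm (LinearMap.finrank_le_finrank_of_injective hF) ?_
    rwa [Module.finrank_prod]
  refine ⟨(Representation.Equiv.mk (LinearEquiv.ofInjectiveOfFinrankEq F hF hdim) ?_).symm⟩
  intro s
  ext p
  · change f (ρ s p) + g (σ s 0) = τ s (f p + g 0)
    simp [f.isIntertwining]
  · change f (ρ s 0) + g (σ s p) = τ s (f 0 + g p)
    simp [g.isIntertwining]

end Irreducible

/-! ### Half turns and quarter turns in Spin(9). -/

section SpinElements

lemma Q9_eq_neg_inner (v : V9) : Q9 v = -inner ℝ v v := rfl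

lemma ι_mul_ι_self {v : V9} (hv : inner ℝ v v = (1 : ℝ)) :
    CliffordAlgebra.ι Q9 v * CliffordAlgebra.ι Q9 v = -1 := by
  rw [CliffordAlgebra.ι_sq_scalar, Q9_eq_neg_inner, hv, map_neg, map_one]

lemma ι_mem_pinGroup {v : V9} (hv : inner ℝ v v = (1 : ℝ)) :
    CliffordAlgebra.ι Q9 v ∈ pinGroup Q9 := by
  have h1 : CliffordAlgebra.ι Q9 v * -CliffordAlgebra.ι Q9 v = 1 := by
    rw [mul_neg, ι_mul_ι_self hv, neg_neg]
  have h2 : -CliffordAlgebra.ι Q9 v * CliffordAlgebra.ι Q9 v = 1 := by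
    rw [neg_mul, ι_mul_ι_self hv, neg_neg]
  refine ⟨⟨⟨_, _, h1, h2⟩, Subgroup.subset_closure ⟨v, rfl⟩, rfl⟩, ?_⟩
  refine Unitary.mem_iff.mpr ?_
  rw [CliffordAlgebra.star_ι]
  exact ⟨h2, h1⟩

lemma ι_mul_ι_mem_spinGroup {u v : V9} (hu : inner ℝ u u = (1 : ℝ)) (hv : inner ℝ v v = (1 : ℝ)) :
    CliffordAlgebra.ι Q9 u * CliffordAlgebra.ι Q9 v ∈ spinGroup Q9 :=
  ⟨mul_mem (ι_mem_pinGroup hu) (ι_mem_pinGroup hv),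
    CliffordAlgebra.ι_mul_ι_mem_evenOdd_zero Q9 u v⟩

/-- The product of two unit vectors in the spin group. -/
def mulUnit (u v : V9) (hu : inner ℝ u u = (1 : ℝ)) (hv : inner ℝ v v = (1 : ℝ)) : Spin9 :=
  ⟨_, ι_mul_ι_mem_spinGroup hu hv⟩

lemma spinRep_mulUnit (u v : V9) (hu hv) :
    spinRep (mulUnit u v hu hv) = -(starMul u * starMul v) :=
  evenAction_ι_mul_ι u v

/-- For a unit vector u⁻¹ = -u, so uwu = -uwu⁻¹ is the reflection of w in the hyperplane orthogonal
to u. A product of two unit vectors therefore acts as a product of two reflections. -/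
lemma ι_conj {u : V9} (hu : inner ℝ u u = (1 : ℝ)) (w : V9) :
    CliffordAlgebra.ι Q9 u * CliffordAlgebra.ι Q9 w * CliffordAlgebra.ι Q9 u =
      CliffordAlgebra.ι Q9 (w - (2 * inner ℝ u w) • u) := by
  have hp : QuadraticMap.polar Q9 u w = -(2 * inner ℝ u w) := by
    rw [QuadraticMap.polar, Q9_eq_neg_inner, Q9_eq_neg_inner, Q9_eq_neg_inner,
      inner_add_left, inner_add_right, inner_add_right, real_inner_comm u w]
    ring
  have h := CliffordAlgebra.ι_mul_ι_add_swap (Q := Q9) u w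
  rw [hp] at h
  rw [eq_sub_of_add_eq h, sub_mul, mul_assoc, ι_mul_ι_self hu, ← Algebra.smul_def, map_sub,
    map_smul, neg_smul, mul_neg, mul_one]
  abel

lemma vectorRep_mulUnit (u v : V9) (hu hv) (w : V9) :
    vectorRep (mulUnit u v hu hv) w =
      (w - (2 * inner ℝ v w) • v) - (2 * inner ℝ u (w - (2 * inner ℝ v w) • v)) • u := by
  apply ι_injective
  rw [← ι_conj hu, ← ι_conj hv]
  change CliffordAlgebra.ι Q9 (vectorMap _ w) = _
  rw [ι_vectorMap]
  change CliffordAlgebra.ι Q9 u * CliffordAlgebra.ι Q9 v * _ *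
    star (CliffordAlgebra.ι Q9 u * CliffordAlgebra.ι Q9 v) = _
  rw [star_mul, CliffordAlgebra.star_ι, CliffordAlgebra.star_ι, neg_mul_neg]
  simp only [mul_assoc]

lemma inner_e (a b : Fin 9) : inner ℝ (e a) (e b) = if a = b then (1 : ℝ) else 0 := by
  simp [e, EuclideanSpace.inner_single_left]

lemma inner_e_self (a : Fin 9) : inner ℝ (e a) (e a) = (1 : ℝ) := by
  rw [inner_e, if_pos rfl]

/-- Clifford multiplication by the basis vector `e a`. -/
abbrev J (a : Fin 9) : Module.End ℝ Delta9 := starMul (e a)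

lemma J_eq (a : Fin 9) : J a = Matrix.toEuclideanLin (I a) := by
  rw [J, starMul_apply, Finset.sum_eq_single a]
  · simp [e]
  · intro b _ hb
    simp [e, hb]
  · simp

lemma J_mul_self (a : Fin 9) : J a * J a = 1 := by
  rw [J_eq, Module.End.mul_eq_comp, ← Matrix.toLpLin_mul_same, I_mul_self, Matrix.toLpLin_one]
  rfl

lemma J_anticomm {a b : Fin 9} (h : a ≠ b) : J a * J b = -(J b * J a) := by
  rw [J_eq, J_eq, Module.End.mul_eq_comp, Module.End.mul_eq_comp, ← Matrix.toLpLin_mul_same,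
    ← Matrix.toLpLin_mul_same, I_anticomm a b h, map_neg]

lemma J_J (a : Fin 9) (ψ : Delta9) : J a (J a ψ) = ψ :=
  LinearMap.congr_fun (J_mul_self a) ψ

lemma J_swap {a b : Fin 9} (h : a ≠ b) (ψ : Delta9) : J a (J b ψ) = -J b (J a ψ) :=
  LinearMap.congr_fun (J_anticomm h) ψ

/-- The element `e a · e b` of the spin group. -/
def halfTurn (a b : Fin 9) : Spin9 := mulUnit (e a) (e b) (inner_e_self a) (inner_e_self b)

lemma spinRep_halfTurn (a b : Fin 9) (ψ : Delta9) :
    spinRep (halfTurn a b) ψ = -J a (J b ψ) := by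
  rw [halfTurn, spinRep_mulUnit]
  rfl

lemma vectorRep_halfTurn {a b : Fin 9} (h : a ≠ b) (c : Fin 9) :
    vectorRep (halfTurn a b) (e c) = (if c = a ∨ c = b then (-1 : ℝ) else 1) • e c := by
  rw [halfTurn, vectorRep_mulUnit]
  simp only [inner_sub_right, inner_smul_right, inner_e]
  by_cases h1 : c = a
  · subst h1
    simp [h, h.symm]
    module
  · by_cases h2 : c = b
    · subst h2
      simp [h]
      module
    · simp [h1, h2, Ne.symm h1, Ne.symm h2]

lemma inner_unit {a b : Fin 9} (h : a ≠ b) :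
    inner ℝ ((√2)⁻¹ • (e b - e a)) ((√2)⁻¹ • (e b - e a)) = (1 : ℝ) := by
  have h2 : (√2)⁻¹ * (√2)⁻¹ = (2 : ℝ)⁻¹ := by
    rw [← mul_inv, Real.mul_self_sqrt (by norm_num)]
  simp only [inner_smul_left, inner_smul_right, inner_sub_left, inner_sub_right, inner_e]
  simp [h, h.symm]
  rw [mul_add, h2]
  norm_num

/-- The element `(1 + e a · e b) / √2` of the spin group. -/
def quarterTurn (a b : Fin 9) (h : a ≠ b) : Spin9 :=
  mulUnit (e a) ((√2)⁻¹ • (e b - e a)) (inner_e_self a) (inner_unit h)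

/-- The part -e_a of the second factor supplies the identity term, since e_a · e_a = -1 in the
Clifford algebra. -/
lemma spinRep_quarterTurn {a b : Fin 9} (h : a ≠ b) (ψ : Delta9) :
    spinRep (quarterTurn a b h) ψ = (√2)⁻¹ • (ψ - J a (J b ψ)) := by
  rw [quarterTurn, spinRep_mulUnit, map_smul, map_sub, mul_smul_comm, mul_sub, J_mul_self]
  simp only [LinearMap.neg_apply, LinearMap.smul_apply, LinearMap.sub_apply, Module.End.mul_apply,
    Module.End.one_apply]
  module

lemma vectorRep_quarterTurn {a b : Fin 9} (h : a ≠ b) (c : Fin 9) :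
    vectorRep (quarterTurn a b h) (e c) =
      if c = a then e b else if c = b then -e a else e c := by
  have h2 : (√2)⁻¹ * (√2)⁻¹ = (2 : ℝ)⁻¹ := by
    rw [← mul_inv, Real.mul_self_sqrt (by norm_num)]
  have h3 : ∀ (x : ℝ) (v : V9), ((√2)⁻¹ * x) • (√2)⁻¹ • v = (2⁻¹ * x) • v := by
    intro x v
    rw [smul_smul, mul_right_comm, h2]
  rw [quarterTurn, vectorRep_mulUnit]
  have h4 : ∀ w : V9, (2 * inner ℝ ((√2)⁻¹ • (e b - e a)) w) • (√2)⁻¹ • (e b - e a) =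
      (inner ℝ (e b - e a) w : ℝ) • (e b - e a) := by
    intro w
    rw [inner_smul_left, mul_left_comm]
    simp only [conj_trivial]
    rw [h3]
    congr 1
    ring
  simp only [h4, inner_sub_left, inner_sub_right, inner_smul_right, inner_e]
  by_cases h1 : c = a
  · subst h1
    simp [h, h.symm]
  · by_cases h2 : c = b
    · subst h2
      simp [h, h.symm]
      module
    · simp [h1, h2, Ne.symm h1, Ne.symm h2]

end SpinElements

/-! ### Even Clifford products generate all 16 × 16 matrices. -/

section SpinorIrreducible

/-- The Kronecker product of four `2 × 2` matrices. -/
abbrev kron4 (A B C D : Matrix (Fin 2) (Fin 2) ℝ) : Matrix SpinorIndex SpinorIndex ℝ :=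
  A ⊗ₖ (B ⊗ₖ (C ⊗ₖ D))

lemma kron4_mul (A B C D A' B' C' D' : Matrix (Fin 2) (Fin 2) ℝ) :
    kron4 A B C D * kron4 A' B' C' D' = kron4 (A * A') (B * B') (C * C') (D * D') := by
  simp only [kron4, ← Matrix.mul_kronecker_mul]

lemma σX_mul_σZ : σX * σZ = σE := by
  ext i j; fin_cases i <;> fin_cases j <;> simp [σX, σZ, σE]

lemma matrix_two_eq (A : Matrix (Fin 2) (Fin 2) ℝ) :
    A = ((A 0 0 + A 1 1) / 2) • 1 + ((A 0 0 - A 1 1) / 2) • σZ + ((A 0 1 + A 1 0) / 2) • σX +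
      ((A 1 0 - A 0 1) / 2) • σE := by
  ext i j; fin_cases i <;> fin_cases j <;> simp [σX, σZ, σE] <;> ring

/-- In nine dimensions the volume element acts as a scalar, so a single `I a` is also an even
product. This lets the even part generate the whole matrix algebra. -/
lemma I_mul_eight : I 1 * (I 2 * (I 3 * (I 4 * (I 5 * (I 6 * (I 7 * I 8)))))) = I 0 := by
  have hZ : σZ * σX = -σE := by rw [σZ_mul_σX, σX_mul_σZ]
  have hZE : σZ * σE = -σX := by
    rw [← σX_mul_σZ, ← mul_assoc, hZ, ← σX_mul_σZ, neg_mul, mul_assoc, σZ_mul_σZ, mul_one]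
  simp [I, ← Matrix.mul_kronecker_mul, σX_mul_σX, σE_mul_σE, σX_mul_σZ, hZE, neg_kron, kron_neg]

/-- Once every `I a` is available, short products isolate σE, σX and σZ in each tensor slot.
Together with 1 they span the 2 × 2 matrices, and products over the four slots give all matrix
units. -/
lemma subalgebra_eq_top (𝒜 : Subalgebra ℝ (Matrix SpinorIndex SpinorIndex ℝ))
    (h : ∀ a b, a ≠ b → I a * I b ∈ 𝒜) : 𝒜 = ⊤ := by
  have h0 : I 0 ∈ 𝒜 := by
    have e1 : I 0 = (I 1 * I 2) * ((I 3 * I 4) * ((I 5 * I 6) * (I 7 * I 8))) := by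
      rw [← I_mul_eight]
      simp only [mul_assoc]
    rw [e1]
    exact mul_mem (h _ _ (by decide)) (mul_mem (h _ _ (by decide))
      (mul_mem (h _ _ (by decide)) (h _ _ (by decide))))
  have hI : ∀ a, I a ∈ 𝒜 := by
    intro a
    by_cases ha : a = 0
    · exact ha ▸ h0
    · have := mul_mem h0 (h 0 a (Ne.symm ha))
      rwa [← mul_assoc, I_mul_self, one_mul] at this
  have hE1 : kron4 σE 1 1 1 ∈ 𝒜 := by
    have := mul_mem (hI 7) (hI 8)
    simpa [kron4, I, ← Matrix.mul_kronecker_mul, σX_mul_σZ] using this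
  have hE2 : kron4 1 σE 1 1 ∈ 𝒜 := by
    have := mul_mem (hI 2) (hI 3)
    simpa [kron4, I, ← Matrix.mul_kronecker_mul, σX_mul_σZ, σE_mul_σE, neg_kron, kron_neg] using this
  have hE3 : kron4 1 1 σE 1 ∈ 𝒜 := by
    have := mul_mem (hI 0) (hI 1)
    simpa [kron4, I, ← Matrix.mul_kronecker_mul, σX_mul_σZ, σE_mul_σE, neg_kron, kron_neg] using this
  have hE4 : kron4 1 1 1 σE ∈ 𝒜 := by
    have := mul_mem (hI 4) (hI 5)
    simpa [kron4, I, ← Matrix.mul_kronecker_mul, σX_mul_σZ, σE_mul_σE, neg_kron, kron_neg] using this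
  have hX3 : kron4 1 1 σX 1 ∈ 𝒜 := by
    have := mul_mem (mul_mem hE1 hE2) (hI 0)
    simpa [kron4, I, ← Matrix.mul_kronecker_mul, σE_mul_σE, neg_kron, kron_neg] using this
  have hZ3 : kron4 1 1 σZ 1 ∈ 𝒜 := by
    have := mul_mem (mul_mem hE1 hE2) (hI 1)
    simpa [kron4, I, ← Matrix.mul_kronecker_mul, σE_mul_σE, neg_kron, kron_neg] using this
  have hX2 : kron4 1 σX 1 1 ∈ 𝒜 := by
    have := mul_mem (mul_mem hE1 hE4) (hI 2)
    simpa [kron4, I, ← Matrix.mul_kronecker_mul, σE_mul_σE, neg_kron, kron_neg] using this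
  have hZ2 : kron4 1 σZ 1 1 ∈ 𝒜 := by
    have := mul_mem (mul_mem hE1 hE4) (hI 3)
    simpa [kron4, I, ← Matrix.mul_kronecker_mul, σE_mul_σE, neg_kron, kron_neg] using this
  have hX4 : kron4 1 1 1 σX ∈ 𝒜 := by
    have := mul_mem (mul_mem hE1 hE3) (hI 4)
    simpa [kron4, I, ← Matrix.mul_kronecker_mul, σE_mul_σE, neg_kron, kron_neg] using this
  have hZ4 : kron4 1 1 1 σZ ∈ 𝒜 := by
    have := mul_mem (mul_mem hE1 hE3) (hI 5)
    simpa [kron4, I, ← Matrix.mul_kronecker_mul, σE_mul_σE, neg_kron, kron_neg] using this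
  have h1 : kron4 1 1 1 1 ∈ 𝒜 := by simp [kron4, one_mem]
  have hA : ∀ A, kron4 A 1 1 1 ∈ 𝒜 := fun A => by
    rw [matrix_two_eq A]
    simp only [kron4, Matrix.add_kronecker, Matrix.smul_kronecker]
    exact add_mem (add_mem (add_mem (𝒜.smul_mem h1 _) (𝒜.smul_mem (hI 8) _))
      (𝒜.smul_mem (hI 7) _)) (𝒜.smul_mem hE1 _)
  have hB : ∀ B, kron4 1 B 1 1 ∈ 𝒜 := fun B => by
    rw [matrix_two_eq B]
    simp only [kron4, Matrix.add_kronecker, Matrix.smul_kronecker, Matrix.kronecker_add,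
      Matrix.kronecker_smul]
    exact add_mem (add_mem (add_mem (𝒜.smul_mem h1 _) (𝒜.smul_mem hZ2 _))
      (𝒜.smul_mem hX2 _)) (𝒜.smul_mem hE2 _)
  have hC : ∀ C, kron4 1 1 C 1 ∈ 𝒜 := fun C => by
    rw [matrix_two_eq C]
    simp only [kron4, Matrix.add_kronecker, Matrix.smul_kronecker, Matrix.kronecker_add,
      Matrix.kronecker_smul]
    exact add_mem (add_mem (add_mem (𝒜.smul_mem h1 _) (𝒜.smul_mem hZ3 _))
      (𝒜.smul_mem hX3 _)) (𝒜.smul_mem hE3 _)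
  have hD : ∀ D, kron4 1 1 1 D ∈ 𝒜 := fun D => by
    rw [matrix_two_eq D]
    simp only [kron4, Matrix.kronecker_add, Matrix.kronecker_smul]
    exact add_mem (add_mem (add_mem (𝒜.smul_mem h1 _) (𝒜.smul_mem hZ4 _))
      (𝒜.smul_mem hX4 _)) (𝒜.smul_mem hE4 _)
  have hall : ∀ A B C D, kron4 A B C D ∈ 𝒜 := fun A B C D => by
    have := mul_mem (mul_mem (hA A) (hB B)) (mul_mem (hC C) (hD D))
    simpa only [kron4_mul, mul_one, one_mul] using this
  rw [eq_top_iff]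
  intro M _
  rw [Matrix.matrix_eq_sum_single M]
  refine sum_mem fun i _ => sum_mem fun j _ => ?_
  obtain ⟨i1, i2, i3, i4⟩ := i
  obtain ⟨j1, j2, j3, j4⟩ := j
  have := hall (Matrix.single i1 j1 (M (i1, i2, i3, i4) (j1, j2, j3, j4)))
    (Matrix.single i2 j2 1) (Matrix.single i3 j3 1) (Matrix.single i4 j4 1)
  simpa only [kron4, Matrix.single_kronecker_single, mul_one] using this

lemma spinor_submodule_eq_top (U : Submodule ℝ Delta9)
    (h : ∀ a b, a ≠ b → ∀ x ∈ U, J a (J b x) ∈ U) (hU : U ≠ ⊥) : U = ⊤ := by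
  let 𝒜 : Subalgebra ℝ (Matrix SpinorIndex SpinorIndex ℝ) :=
    { carrier := {M | ∀ x ∈ U, Matrix.toEuclideanLin M x ∈ U}
      mul_mem' := by
        intro M N hM hN x hx
        have e1 : Matrix.toEuclideanLin (M * N) x =
            Matrix.toEuclideanLin M (Matrix.toEuclideanLin N x) := by
          rw [Matrix.toLpLin_mul_same]
          rfl
        rw [e1]
        exact hM _ (hN _ hx)
      add_mem' := by
        intro M N hM hN x hx
        rw [map_add]
        exact add_mem (hM _ hx) (hN _ hx)
      algebraMap_mem' := by
        intro r x hx
        rw [Algebra.algebraMap_eq_smul_one, map_smul, Matrix.toLpLin_one]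
        exact U.smul_mem r hx }
  have htop : 𝒜 = ⊤ := by
    refine subalgebra_eq_top 𝒜 fun a b hab x hx => ?_
    rw [Matrix.toLpLin_mul_same, ← J_eq, ← J_eq]
    exact h a b hab x hx
  obtain ⟨x, hx, hx0⟩ := Submodule.exists_mem_ne_zero_of_ne_bot hU
  obtain ⟨j, hj⟩ : ∃ j, x j ≠ 0 := by
    by_contra hcon
    push Not at hcon
    exact hx0 (PiLp.ext hcon)
  rw [eq_top_iff]
  intro y _
  -- A matrix with the single nonzero column j, scaled to send x to the arbitrary target y.
  let M : Matrix SpinorIndex SpinorIndex ℝ := Matrix.of fun i k => if k = j then y i / x j else 0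
  have hM : M ∈ 𝒜 := htop ▸ Algebra.mem_top
  have hy : Matrix.toEuclideanLin M x = y := by
    ext i
    rw [Matrix.toLpLin_apply]
    simp [M, Matrix.mulVec, dotProduct, div_mul_cancel₀ _ hj]
  rw [← hy]
  exact hM x hx

end SpinorIrreducible

/-! ### Irreducibility of Λᵏ(ℝ⁹) for 2k < 9. -/

section ExteriorIrreducible

/-- The decomposable element `v 0 ∧ ⋯ ∧ v (k - 1)`. -/
def wedge {V : Type} [AddCommGroup V] [Module ℝ V] (k : ℕ) : V [⋀^Fin k]→ₗ[ℝ] Ext k V :=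
  exteriorPower.ιMulti ℝ k

lemma extMap_wedge {V : Type} [AddCommGroup V] [Module ℝ V] (k : ℕ) (f : V →ₗ[ℝ] V)
    (v : Fin k → V) : extMap k f (wedge k v) = wedge k (f ∘ v) :=
  exteriorPower.map_apply_ιMulti f v

lemma extRep_wedge {V : Type} [AddCommGroup V] [Module ℝ V] {G : Type} [Monoid G] (k : ℕ)
    (ρ : Representation ℝ G V) (g : G) (v : Fin k → V) :
    extRep k ρ g (wedge k v) = wedge k (fun i => ρ g (v i)) :=
  extMap_wedge k (ρ g) v

lemma wedge_smul {V : Type} [AddCommGroup V] [Module ℝ V] (k : ℕ) (c : Fin k → ℝ)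
    (v : Fin k → V) : wedge k (fun i => c i • v i) = (∏ i, c i) • wedge k v :=
  (wedge k).toMultilinearMap.map_smul_univ c v

/-- The standard basis of `Λᵏ(ℝ⁹)`. -/
def extBasis (k : ℕ) : Module.Basis (Set.powersetCard (Fin 9) k) ℝ (Ext k V9) :=
  (EuclideanSpace.basisFun (Fin 9) ℝ).toBasis.exteriorPower k

lemma extBasis_apply (k : ℕ) (S : Set.powersetCard (Fin 9) k) :
    extBasis k S = wedge k (fun i => e (Set.powersetCard.ofFinEmbEquiv.symm S i)) := by
  refine (exteriorPower.basis_apply (R := ℝ) k _ S).trans ?_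
  rw [exteriorPower.ιMulti_family]
  change exteriorPower.ιMulti ℝ k _ = exteriorPower.ιMulti ℝ k _
  congr 1
  ext1 i
  simp [e]

lemma vectorRep_quarterTurn_swap {a b : Fin 9} (h : a ≠ b) (c : Fin 9) :
    vectorRep (quarterTurn a b h) (e c) =
      (if c = b then (-1 : ℝ) else 1) • e (Equiv.swap a b c) := by
  rw [vectorRep_quarterTurn]
  by_cases h1 : c = a
  · subst h1
    simp [h]
  · by_cases h2 : c = b
    · subst h2
      simp [h1]
    · simp [h1, h2, Equiv.swap_apply_of_ne_of_ne]

lemma extRep_quarterTurn_wedge (k : ℕ) {a b : Fin 9} (h : a ≠ b) (t : Fin k → Fin 9) :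
    extRep k vectorRep (quarterTurn a b h) (wedge k (fun i => e (t i))) =
      (∏ i, if t i = b then (-1 : ℝ) else 1) • wedge k (fun i => e (Equiv.swap a b (t i))) := by
  rw [extRep_wedge]
  simp only [vectorRep_quarterTurn_swap]
  rw [wedge_smul]

/-- The eigenvalue of `halfTurn a b` on a basis vector of `Λᵏ(ℝ⁹)`. -/
def halfTurnSign (k : ℕ) (a b : Fin 9) (S : Set.powersetCard (Fin 9) k) : ℝ :=
  ∏ i, if Set.powersetCard.ofFinEmbEquiv.symm S i = a ∨ Set.powersetCard.ofFinEmbEquiv.symm S i = b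
    then (-1 : ℝ) else 1

lemma extRep_halfTurn_extBasis (k : ℕ) {a b : Fin 9} (h : a ≠ b) (S : Set.powersetCard (Fin 9) k) :
    extRep k vectorRep (halfTurn a b) (extBasis k S) = halfTurnSign k a b S • extBasis k S := by
  rw [extBasis_apply, extRep_wedge]
  simp only [vectorRep_halfTurn h]
  rw [wedge_smul]
  rfl

lemma repr_extRep_halfTurn (k : ℕ) {a b : Fin 9} (h : a ≠ b) (S : Set.powersetCard (Fin 9) k)
    (x : Ext k V9) :
    (extBasis k).repr (extRep k vectorRep (halfTurn a b) x) S =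
      halfTurnSign k a b S * (extBasis k).repr x S := by
  have : (extBasis k).coord S ∘ₗ extRep k vectorRep (halfTurn a b) =
      halfTurnSign k a b S • (extBasis k).coord S := by
    apply (extBasis k).ext
    intro T
    simp only [LinearMap.comp_apply, LinearMap.smul_apply, extRep_halfTurn_extBasis k h, map_smul,
      Module.Basis.coord_apply, Module.Basis.repr_self, Finsupp.single_apply, smul_eq_mul]
    split_ifs with hST
    · rw [hST]
    · simp
  exact LinearMap.congr_fun this x

lemma halfTurnSign_of_notMem {k : ℕ} {a b : Fin 9} {S : Set.powersetCard (Fin 9) k}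
    (ha : a ∉ S) (hb : b ∉ S) : halfTurnSign k a b S = 1 := by
  refine Finset.prod_eq_one fun i _ => if_neg ?_
  have hi : Set.powersetCard.ofFinEmbEquiv.symm S i ∈ S :=
    (Set.powersetCard.mem_range_ofFinEmbEquiv_symm_iff_mem S _).mp ⟨i, rfl⟩
  rintro (h | h)
  · exact ha (h ▸ hi)
  · exact hb (h ▸ hi)

lemma halfTurnSign_of_mem {k : ℕ} {a b : Fin 9} {S : Set.powersetCard (Fin 9) k}
    (ha : a ∈ S) (hb : b ∉ S) : halfTurnSign k a b S = -1 := by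
  obtain ⟨i, hi⟩ := (Set.powersetCard.mem_range_ofFinEmbEquiv_symm_iff_mem S a).mpr ha
  rw [halfTurnSign, Finset.prod_eq_single i]
  · exact if_pos (Or.inl hi)
  · intro j _ hj
    refine if_neg ?_
    have hjS : Set.powersetCard.ofFinEmbEquiv.symm S j ∈ S :=
      (Set.powersetCard.mem_range_ofFinEmbEquiv_symm_iff_mem S _).mp ⟨j, rfl⟩
    rintro (h | h)
    · exact hj ((Set.powersetCard.ofFinEmbEquiv.symm S).injective (h.trans hi.symm))
    · exact hb (h ▸ hjS)
  · simp

/-- A nonzero vector of W with smallest support has one-point support: otherwise some half turn has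
different signs on two index sets T, T' of the support, and a combination removes one of them. -/
lemma exists_extBasis_mem (k : ℕ) (hk : 2 * k < 9) (W : Submodule ℝ (Ext k V9))
    (hW : ∀ g, ∀ x ∈ W, extRep k vectorRep g x ∈ W) (hne : W ≠ ⊥) : ∃ S, extBasis k S ∈ W := by
  classical
  have hex : ∃ n, ∃ x ∈ W, x ≠ 0 ∧ ((extBasis k).repr x).support.card = n := by
    obtain ⟨x, hx, hx0⟩ := Submodule.exists_mem_ne_zero_of_ne_bot hne
    exact ⟨_, x, hx, hx0, rfl⟩
  obtain ⟨x, hx, hx0, hcard⟩ := Nat.find_spec hex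
  have hmin : ∀ y ∈ W, y ≠ 0 →
      ((extBasis k).repr x).support.card ≤ ((extBasis k).repr y).support.card :=
    fun y hy hy0 => hcard.trans_le (Nat.find_min' hex ⟨y, hy, hy0, rfl⟩)
  have hrx : (extBasis k).repr x ≠ 0 := by simpa using hx0
  obtain ⟨T, hT⟩ := Finsupp.support_nonempty_iff.mpr hrx
  have hT' := Finsupp.mem_support_iff.mp hT
  have huniq : ∀ T', (extBasis k).repr x T' ≠ 0 → T' = T := by
    intro T' hT'x
    by_contra hTT'
    obtain ⟨a, haT, haT'⟩ := (Set.powersetCard.exists_mem_notMem_iff_ne T T').mp (Ne.symm hTT')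
    -- The bound 2k < 9 leaves an index outside both sets; with a in T but not in T', the half turn
    -- in the plane (a, b) has sign -1 on T and +1 on T'.
    obtain ⟨b, hb⟩ : ∃ b, b ∉ T.1 ∪ T'.1 := by
      by_contra hcon
      push Not at hcon
      have h1 : (Finset.univ : Finset (Fin 9)).card ≤ (T.1 ∪ T'.1).card :=
        Finset.card_le_card fun b _ => hcon b
      have h2 := Finset.card_union_le T.1 T'.1
      have h3 : T.1.card = k := T.2
      have h4 : T'.1.card = k := T'.2
      rw [Finset.card_univ, Fintype.card_fin] at h1
      omega
    rw [Finset.mem_union, not_or] at hb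
    have hab : a ≠ b := by
      rintro rfl
      exact hb.1 haT
    -- The coordinate at T is doubled and the one at T' vanishes, so y is nonzero with strictly
    -- smaller support.
    let y := x - extRep k vectorRep (halfTurn a b) x
    have hyr : ∀ S, (extBasis k).repr y S =
        (1 - halfTurnSign k a b S) * (extBasis k).repr x S := by
      intro S
      rw [map_sub, Finsupp.sub_apply, repr_extRep_halfTurn k hab]
      ring
    have hyT : (extBasis k).repr y T ≠ 0 := by
      rw [hyr, halfTurnSign_of_mem haT hb.1]
      norm_num
      exact hT'
    have hy0 : y ≠ 0 := by
      intro hy0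
      rw [hy0] at hyT
      simp at hyT
    have hle := hmin y (sub_mem hx (hW _ x hx)) hy0
    refine absurd hle (not_le.mpr (Finset.card_lt_card ⟨?_, ?_⟩))
    · intro S hS
      rw [Finsupp.mem_support_iff, hyr] at hS
      exact Finsupp.mem_support_iff.mpr (right_ne_zero_of_mul hS)
    · intro hsub
      have := hsub (Finsupp.mem_support_iff.mpr hT'x)
      rw [Finsupp.mem_support_iff, hyr, halfTurnSign_of_notMem haT' hb.2] at this
      simp at this
  refine ⟨T, ?_⟩
  have hxT : x = (extBasis k).repr x T • extBasis k T := by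
    apply (extBasis k).repr.injective
    ext S
    rw [map_smul, Module.Basis.repr_self, Finsupp.smul_apply, Finsupp.single_apply]
    split_ifs with h
    · simp [h]
    · rw [smul_zero]
      by_contra h0
      exact h (huniq S h0).symm
  rw [hxT] at hx
  exact (W.smul_mem_iff hT').mp hx

lemma extRep_vectorRep_isIrreducible (k : ℕ) (hk : 2 * k < 9) :
    (extRep k vectorRep).IsIrreducible := by
  have : Nonempty (Set.powersetCard (Fin 9) k) := by
    obtain ⟨S, hS⟩ := Finset.exists_subset_card_eq (s := (Finset.univ : Finset (Fin 9))) (n := k)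
      (by rw [Finset.card_univ, Fintype.card_fin]; omega)
    exact ⟨⟨S, hS.2⟩⟩
  have : Nontrivial (Ext k V9) := ⟨⟨_, _, (extBasis k).ne_zero this.some⟩⟩
  refine isIrreducible_of_invariant _ fun W hW hne => ?_
  obtain ⟨S, hS⟩ := exists_extBasis_mem k hk W hW hne
  -- Quarter turns realise transpositions of the indices up to a nonzero sign, and transpositions
  -- generate the symmetric group.
  have hperm : ∀ σ : Equiv.Perm (Fin 9), ∀ t : Fin k → Fin 9, wedge k (fun i => e (t i)) ∈ W →
      wedge k (fun i => e (σ (t i))) ∈ W := by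
    intro σ
    induction σ using Equiv.Perm.swap_induction_on with
    | one => exact fun t ht => ht
    | swap_mul σ a b hab ih =>
      intro t ht
      have h1 := hW (quarterTurn a b hab) _ (ih t ht)
      rw [extRep_quarterTurn_wedge] at h1
      refine (W.smul_mem_iff ?_).mp h1
      refine Finset.prod_ne_zero_iff.mpr fun i _ => ?_
      split_ifs <;> norm_num
  rw [eq_top_iff, ← (extBasis k).span_eq, Submodule.span_le]
  rintro _ ⟨T, rfl⟩
  have hpre := Equiv.Perm.isMultiplyPretransitive (Fin 9) k
  obtain ⟨σ, hσ⟩ := hpre.exists_smul_eq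
    (Set.powersetCard.ofFinEmbEquiv.symm S).toEmbedding
    (Set.powersetCard.ofFinEmbEquiv.symm T).toEmbedding
  rw [extBasis_apply] at hS
  have h2 := hperm σ _ hS
  rw [SetLike.mem_coe, extBasis_apply]
  convert h2 using 3 with i
  exact congrArg e (DFunLike.congr_fun hσ i).symm

end ExteriorIrreducible

/-! ### Coordinates on spinor-valued 1-forms and 2-forms. -/

section Forms

/-- The determinant of the images of `k` vectors under a linear map to `ℝᵏ`. -/
def detForm {V : Type} [AddCommGroup V] [Module ℝ V] (k : ℕ) (l : V →ₗ[ℝ] Fin k → ℝ) :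
    Ext k V →ₗ[ℝ] ℝ :=
  exteriorPower.alternatingMapLinearEquiv (Matrix.detRowAlternating.compLinearMap l)

lemma detForm_wedge {V : Type} [AddCommGroup V] [Module ℝ V] (k : ℕ) (l : V →ₗ[ℝ] Fin k → ℝ)
    (v : Fin k → V) : detForm k l (wedge k v) = Matrix.det (Matrix.of fun i j => l (v i) j) :=
  exteriorPower.alternatingMapLinearEquiv_apply_ιMulti _ _

lemma toExt_wedge_one {V : Type} [AddCommGroup V] [Module ℝ V] (v : Fin 1 → V) :
    toExt 1 (wedge 1 v) = CliffordAlgebra.ι (0 : QuadraticForm ℝ V) (v 0) := by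
  refine (exteriorPower.ιMulti_apply_coe (R := ℝ) (n := 1) v).trans ?_
  rw [ExteriorAlgebra.ιMulti_apply]
  simp [List.ofFn_succ, ExteriorAlgebra.ι]

lemma toExt_wedge_zero {V : Type} [AddCommGroup V] [Module ℝ V] (v : Fin 0 → V) :
    toExt 0 (wedge 0 v) = (1 : CliffordAlgebra (0 : QuadraticForm ℝ V)) := by
  refine (exteriorPower.ιMulti_apply_coe (R := ℝ) (n := 0) v).trans ?_
  rw [ExteriorAlgebra.ιMulti_apply]
  simp

lemma toExt_wedge_two {V : Type} [AddCommGroup V] [Module ℝ V] (v : Fin 2 → V) :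
    toExt 2 (wedge 2 v) = CliffordAlgebra.ι (0 : QuadraticForm ℝ V) (v 0) *
      CliffordAlgebra.ι (0 : QuadraticForm ℝ V) (v 1) := by
  refine (exteriorPower.ιMulti_apply_coe (R := ℝ) (n := 2) v).trans ?_
  rw [ExteriorAlgebra.ιMulti_apply]
  simp [List.ofFn_succ, ExteriorAlgebra.ι]

lemma contract_wedge_one {V : Type} [AddCommGroup V] [Module ℝ V] (d : Module.Dual ℝ V)
    (v : V) : contract d 0 (wedge 1 ![v]) = d v • wedge 0 ![] := by
  apply toExt_injective
  rw [contract_coe, map_smul, toExt_wedge_one, toExt_wedge_zero]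
  refine (CliffordAlgebra.contractLeft_ι (Q := (0 : QuadraticForm ℝ V)) d v).trans ?_
  rw [Algebra.algebraMap_eq_smul_one]

lemma contract_wedge_two {V : Type} [AddCommGroup V] [Module ℝ V] (d : Module.Dual ℝ V)
    (v w : V) :
    contract d 1 (wedge 2 ![v, w]) = d v • wedge 1 ![w] - d w • wedge 1 ![v] := by
  apply toExt_injective
  rw [contract_coe, map_sub, map_smul, map_smul, toExt_wedge_two, toExt_wedge_one, toExt_wedge_one]
  refine (CliffordAlgebra.contractLeft_ι_mul (Q := (0 : QuadraticForm ℝ V)) (d := d) v _).trans ?_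
  rw [CliffordAlgebra.contractLeft_ι, ← Algebra.commutes, ← Algebra.smul_def]
  rfl

/-- The spinor-valued form `v ⊗ (v ⋆ ψ)`. -/
def form1 (v : V9) : Delta9 →ₗ[ℝ] Ext 1 V9 ⊗[ℝ] Delta9 :=
  TensorProduct.mk ℝ _ _ (wedge 1 ![v]) ∘ₗ starMul v

/-- The spinor-valued form `(v ∧ w) ⊗ (v ⋆ (w ⋆ ψ))`. -/
def form2 (v w : V9) : Delta9 →ₗ[ℝ] Ext 2 V9 ⊗[ℝ] Delta9 :=
  TensorProduct.mk ℝ _ _ (wedge 2 ![v, w]) ∘ₗ starMul v ∘ₗ starMul w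

lemma form1_apply (v : V9) (ψ : Delta9) : form1 v ψ = wedge 1 ![v] ⊗ₜ starMul v ψ := rfl

lemma form2_apply (v w : V9) (ψ : Delta9) :
    form2 v w ψ = wedge 2 ![v, w] ⊗ₜ starMul v (starMul w ψ) := rfl

lemma formRep_form1 (g : Spin9) (v : V9) (ψ : Delta9) :
    formRep 1 g (form1 v ψ) = form1 (vectorRep g v) (spinRep g ψ) := by
  rw [form1_apply, form1_apply, spinRep_starMul]
  change extRep 1 vectorRep g (wedge 1 ![v]) ⊗ₜ[ℝ] _ = _
  rw [extRep_wedge]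
  congr 2
  ext1 i
  fin_cases i
  rfl

lemma formRep_form2 (g : Spin9) (v w : V9) (ψ : Delta9) :
    formRep 2 g (form2 v w ψ) = form2 (vectorRep g v) (vectorRep g w) (spinRep g ψ) := by
  rw [form2_apply, form2_apply, spinRep_starMul, spinRep_starMul]
  change extRep 2 vectorRep g (wedge 2 ![v, w]) ⊗ₜ[ℝ] _ = _
  rw [extRep_wedge]
  congr 2
  ext1 i
  fin_cases i <;> rfl

/-- The vector enters twice, so the signs produced by half and quarter turns on the basis vectors
cancel. This is the reason for inserting `starMul v`; `form2_smul_smul` plays the same role for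
2-forms. -/
lemma form1_smul (c : ℝ) (v : V9) : form1 (c • v) = (c * c) • form1 v := by
  ext1 ψ
  have h : wedge 1 ![c • v] = c • wedge 1 ![v] := by
    have := wedge_smul 1 ![c] ![v]
    simpa [Matrix.smul_cons, ← Matrix.vec_single_eq_const] using this
  rw [LinearMap.smul_apply, form1_apply, form1_apply, h, map_smul, LinearMap.smul_apply,
    TensorProduct.tmul_smul, ← TensorProduct.smul_tmul', smul_smul]

lemma wedge_two_smul_smul {V : Type} [AddCommGroup V] [Module ℝ V] (c d : ℝ) (v w : V) :
    wedge 2 ![c • v, d • w] = (c * d) • wedge 2 ![v, w] := by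
  have := wedge_smul 2 ![c, d] ![v, w]
  rw [Fin.prod_univ_two] at this
  simp only [Matrix.cons_val_zero, Matrix.cons_val_one] at this
  rw [← this]
  congr 1
  ext1 i
  fin_cases i <;> rfl

lemma form2_smul_smul (c d : ℝ) (v w : V9) :
    form2 (c • v) (d • w) = ((c * d) * (c * d)) • form2 v w := by
  ext1 ψ
  rw [LinearMap.smul_apply, form2_apply, form2_apply, wedge_two_smul_smul]
  simp only [map_smul, LinearMap.smul_apply, TensorProduct.tmul_smul, smul_smul,
    ← TensorProduct.smul_tmul']
  congr 1
  ring

lemma wedge_two_swap {V : Type} [AddCommGroup V] [Module ℝ V] (v w : V) :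
    wedge 2 ![w, v] = -wedge 2 ![v, w] := by
  have h := (wedge (V := V) 2).map_swap ![v, w] (i := 0) (j := 1) (by decide)
  rw [← h]
  congr 1
  ext1 i
  fin_cases i <;> rfl

lemma form2_e_self (a : Fin 9) : form2 (e a) (e a) = 0 := by
  ext1 ψ
  rw [form2_apply, (wedge 2).map_eq_zero_of_eq _ (i := 0) (j := 1) rfl (by decide),
    TensorProduct.zero_tmul, LinearMap.zero_apply]

/-- The sign of the wedge cancels the sign of the anticommuting multiplications, so these forms are
indexed by unordered pairs, the edges of the complete graph on nine vertices. -/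
lemma form2_e_comm (a b : Fin 9) : form2 (e a) (e b) = form2 (e b) (e a) := by
  by_cases h : a = b
  · rw [h]
  · ext1 ψ
    rw [form2_apply, form2_apply, wedge_two_swap, J_swap h, TensorProduct.tmul_neg,
      TensorProduct.neg_tmul, neg_neg]

lemma thetaStar_form1 (a : Fin 9) (ψ : Delta9) :
    thetaStar 0 (form1 (e a) ψ) = -(wedge 0 ![] ⊗ₜ ψ) := by
  rw [form1_apply, thetaStar_tmul, Finset.sum_eq_single a]
  · rw [contract_wedge_one, J_J]
    simp only [innerₗ_apply_apply, inner_e_self, one_smul]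
  · intro b _ hb
    rw [contract_wedge_one]
    simp [inner_e, hb]
  · simp

/-- Contracting one index also cancels its Clifford factor, since `J` squares to 1. Up to sign, Θ*
sends an edge to the sum of its endpoints. -/
lemma thetaStar_form2 {a b : Fin 9} (h : a ≠ b) (ψ : Delta9) :
    thetaStar 1 (form2 (e a) (e b) ψ) = -(form1 (e a) ψ + form1 (e b) ψ) := by
  rw [form2_apply, thetaStar_tmul, ← Finset.sum_subset (Finset.subset_univ {a, b}),
    Finset.sum_pair h]
  · simp only [contract_wedge_two, J_J, innerₗ_apply_apply, inner_e]
    rw [J_swap h, map_neg, J_J]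
    simp [h, h.symm, TensorProduct.tmul_neg, TensorProduct.neg_tmul, form1_apply]
    abel
  · intro c _ hc
    rw [contract_wedge_two]
    simp only [Finset.mem_insert, Finset.mem_singleton, not_or] at hc
    simp [inner_e, hc.1, hc.2]

/-- The sum of the spinor-valued forms `e a ⊗ (e a ⋆ y a)`. -/
def sum1 : (Fin 9 → Delta9) →ₗ[ℝ] Ext 1 V9 ⊗[ℝ] Delta9 :=
  ∑ a, form1 (e a) ∘ₗ LinearMap.proj a

/-- The sum of the spinor-valued forms `(e a ∧ e b) ⊗ (e a ⋆ (e b ⋆ y a b))`. -/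
def sum2 : (Fin 9 × Fin 9 → Delta9) →ₗ[ℝ] Ext 2 V9 ⊗[ℝ] Delta9 :=
  ∑ t, form2 (e t.1) (e t.2) ∘ₗ LinearMap.proj t

lemma sum1_apply (y : Fin 9 → Delta9) : sum1 y = ∑ a, form1 (e a) (y a) := by
  simp [sum1]

lemma sum2_apply (y : Fin 9 × Fin 9 → Delta9) : sum2 y = ∑ t, form2 (e t.1) (e t.2) (y t) := by
  simp [sum2]

lemma sum1_single (a : Fin 9) (ψ : Delta9) : sum1 (Pi.single a ψ) = form1 (e a) ψ := by
  rw [sum1_apply, Finset.sum_eq_single a]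
  · simp
  · intro b _ hb
    simp [hb]
  · simp

lemma sum2_single (t : Fin 9 × Fin 9) (ψ : Delta9) :
    sum2 (Pi.single t ψ) = form2 (e t.1) (e t.2) ψ := by
  rw [sum2_apply, Finset.sum_eq_single t]
  · simp
  · intro b _ hb
    simp [hb]
  · simp

lemma submodule_eq_top_of_extBasis_tmul {k : ℕ} (R : Submodule ℝ (Ext k V9 ⊗[ℝ] Delta9))
    (h : ∀ (t : Fin k → Fin 9) φ, wedge k (fun i => e (t i)) ⊗ₜ φ ∈ R) : R = ⊤ := by
  rw [eq_top_iff]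
  intro x _
  induction x using TensorProduct.induction_on with
  | zero => exact zero_mem R
  | add x y hx hy => exact add_mem (hx trivial) (hy trivial)
  | tmul ω φ =>
    rw [← (extBasis k).sum_repr ω, TensorProduct.sum_tmul]
    refine sum_mem fun S _ => ?_
    rw [← TensorProduct.smul_tmul', extBasis_apply]
    exact R.smul_mem _ (h _ φ)

lemma sum1_surjective : Function.Surjective sum1 := by
  rw [← LinearMap.range_eq_top]
  refine submodule_eq_top_of_extBasis_tmul _ fun t φ => ⟨Pi.single (t 0) (J (t 0) φ), ?_⟩
  rw [sum1_single, form1_apply, J_J]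
  congr 2
  ext1 i
  fin_cases i
  rfl

lemma sum2_surjective : Function.Surjective sum2 := by
  rw [← LinearMap.range_eq_top]
  refine submodule_eq_top_of_extBasis_tmul _ fun t φ =>
    ⟨Pi.single (t 0, t 1) (J (t 1) (J (t 0) φ)), ?_⟩
  rw [sum2_single, form2_apply, J_J, J_J]
  congr 2
  ext1 i
  fin_cases i <;> rfl

lemma e_ne_zero (a : Fin 9) : e a ≠ 0 := by
  intro h
  have := inner_e_self a
  rw [h, inner_zero_left] at this
  exact zero_ne_one this

lemma sum1_injective : Function.Injective sum1 := by
  rw [← LinearMap.ker_eq_bot, LinearMap.ker_eq_bot']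
  intro y hy
  ext1 a
  -- This form reads off the coefficient of `e a`, leaving `J a (y a)`, and `J a` is invertible.
  let l : V9 →ₗ[ℝ] Fin 1 → ℝ := LinearMap.pi fun _ => innerₗ V9 (e a)
  have h := congrArg ((TensorProduct.lid ℝ Delta9).toLinearMap ∘ₗ LinearMap.rTensor Delta9 (detForm 1 l)) hy
  rw [sum1_apply, map_sum, Finset.sum_eq_single a] at h
  · have h3 : e a = 0 ∨ J a (y a) = 0 := by
      simpa [form1_apply, detForm_wedge, l, inner_e] using h
    have h2 := h3.resolve_left (e_ne_zero a)
    rw [← J_J a (y a), h2, map_zero]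
    rfl
  · intro b _ hb
    simp [form1_apply, detForm_wedge, l, inner_e, hb.symm]
  · simp

end Forms

/-! ### Index permutations from the group algebra. -/

section Transposition

variable {X : Type*} [AddCommGroup X] [Module ℝ X] (τ : Representation ℝ Spin9 X)

/-- The operator `(r - r h) / √2` for the quarter turn `r` and the half turn `h` in the plane of
`e a` and `e b`. -/
def transposition (a b : Fin 9) (h : a ≠ b) : Module.End ℝ X :=
  (√2)⁻¹ • (τ (quarterTurn a b h) - τ (quarterTurn a b h) * τ (halfTurn a b))

variable {τ}

lemma transposition_mem {W : Submodule ℝ X} (hW : ∀ g, ∀ x ∈ W, τ g x ∈ W) {a b : Fin 9}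
    (h : a ≠ b) {x : X} (hx : x ∈ W) : transposition τ a b h x ∈ W :=
  W.smul_mem _ (sub_mem (hW _ x hx) (hW _ _ (hW _ x hx)))

/-- On spinors the half turn h satisfies h² = -1 and the quarter turn is r = (1 + h)/√2, so r - rh =
(1 + h)(1 - h)/√2 = √2. The spinor is left unchanged and only the passage from p to q remains. -/
lemma transposition_apply {a b : Fin 9} (h : a ≠ b) (p q : Delta9 →ₗ[ℝ] X)
    (hp : ∀ ψ, τ (halfTurn a b) (p ψ) = p (spinRep (halfTurn a b) ψ))
    (hq : ∀ ψ, τ (quarterTurn a b h) (p ψ) = q (spinRep (quarterTurn a b h) ψ)) (ψ : Delta9) :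
    transposition τ a b h (p ψ) = q ψ := by
  have h2 : (√2)⁻¹ * (√2)⁻¹ = (2 : ℝ)⁻¹ := by
    rw [← mul_inv, Real.mul_self_sqrt (by norm_num)]
  have h3 : spinRep (quarterTurn a b h) ψ -
      spinRep (quarterTurn a b h) (spinRep (halfTurn a b) ψ) = (√2)⁻¹ • (2 : ℝ) • ψ := by
    rw [spinRep_quarterTurn, spinRep_quarterTurn, spinRep_halfTurn]
    have h4 : J a (J b (-J a (J b ψ))) = ψ := by
      rw [map_neg, map_neg, J_swap h.symm (J b ψ), map_neg, neg_neg, J_J, J_J]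
    rw [h4]
    module
  change (√2)⁻¹ • (τ (quarterTurn a b h) (p ψ) -
    τ (quarterTurn a b h) (τ (halfTurn a b) (p ψ))) = q ψ
  rw [hp, hq, hq, ← map_sub, h3, map_smul, map_smul, smul_smul, smul_smul, h2]
  norm_num

/-- When half turns act only on the spinor argument of p, the preimage of W is stable under all even
products, hence everything as soon as it is nonzero. -/
lemma forall_mem_of_mem {W : Submodule ℝ X} (hW : ∀ g, ∀ x ∈ W, τ g x ∈ W) (p : Delta9 →ₗ[ℝ] X)
    (hp : ∀ a b, a ≠ b → ∀ ψ, τ (halfTurn a b) (p ψ) = p (spinRep (halfTurn a b) ψ))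
    {ψ : Delta9} (hψ : ψ ≠ 0) (hmem : p ψ ∈ W) (φ : Delta9) : p φ ∈ W := by
  have h := spinor_submodule_eq_top (W.comap p) ?_ ?_
  · exact (h ▸ Submodule.mem_top : φ ∈ W.comap p)
  · intro a b hab x hx
    have h1 := hW (halfTurn a b) _ hx
    rw [hp a b hab, spinRep_halfTurn, map_neg, neg_mem_iff] at h1
    exact h1
  · intro hbot
    exact hψ ((Submodule.mem_bot ℝ).mp (hbot ▸ hmem : ψ ∈ (⊥ : Submodule ℝ Delta9)))

end Transposition

/-! ### Irreducibility of P₁. -/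

section VectorSpinors

lemma formRep_halfTurn_form1 {a b : Fin 9} (h : a ≠ b) (c : Fin 9) (ψ : Delta9) :
    formRep 1 (halfTurn a b) (form1 (e c) ψ) = form1 (e c) (spinRep (halfTurn a b) ψ) := by
  rw [formRep_form1, vectorRep_halfTurn h, form1_smul, LinearMap.smul_apply]
  split_ifs <;> norm_num

lemma transposition_form1 {a b : Fin 9} (h : a ≠ b) (c : Fin 9) (ψ : Delta9) :
    transposition (formRep 1) a b h (form1 (e c) ψ) = form1 (e (Equiv.swap a b c)) ψ := by
  refine transposition_apply h _ _ (formRep_halfTurn_form1 h c) (fun ψ => ?_) ψ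
  rw [formRep_form1, vectorRep_quarterTurn_swap, form1_smul, LinearMap.smul_apply]
  split_ifs <;> norm_num

lemma transposition_sum1 {a b : Fin 9} (h : a ≠ b) (y : Fin 9 → Delta9) :
    transposition (formRep 1) a b h (sum1 y) = sum1 (fun c => y (Equiv.swap a b c)) := by
  rw [sum1_apply, sum1_apply, map_sum]
  simp only [transposition_form1]
  exact Fintype.sum_equiv (Equiv.swap a b) _ _ fun c => by rw [Equiv.swap_apply_self]

lemma sum1_mem_P_iff (y : Fin 9 → Delta9) : sum1 y ∈ (P 1).toSubmodule ↔ ∑ a, y a = 0 := by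
  have h : thetaStar 0 (sum1 y) = -(wedge 0 ![] ⊗ₜ ∑ a, y a) := by
    rw [sum1_apply, map_sum, TensorProduct.tmul_sum, ← Finset.sum_neg_distrib]
    exact Finset.sum_congr rfl fun a _ => thetaStar_form1 a _
  change thetaStar 0 (sum1 y) = 0 ↔ _
  rw [h, neg_eq_zero]
  refine ⟨fun h0 => ?_, fun h0 => by rw [h0, TensorProduct.tmul_zero]⟩
  -- The empty determinant is 1, so this map strips off the factor `wedge 0 ![]`.
  have h1 := congrArg ((TensorProduct.lid ℝ Delta9).toLinearMap ∘ₗ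
    LinearMap.rTensor Delta9 (detForm 0 (0 : V9 →ₗ[ℝ] Fin 0 → ℝ))) h0
  simpa [detForm_wedge] using h1

/-- The spinor-valued form `e a ⊗ (e a ⋆ ψ) - e b ⊗ (e b ⋆ ψ)`. -/
def diff1 (a b : Fin 9) : Delta9 →ₗ[ℝ] Ext 1 V9 ⊗[ℝ] Delta9 := form1 (e a) - form1 (e b)

lemma diff1_apply (a b : Fin 9) (ψ : Delta9) :
    diff1 a b ψ = form1 (e a) ψ - form1 (e b) ψ := rfl

lemma diff1_perm_mem {W : Submodule ℝ (Ext 1 V9 ⊗[ℝ] Delta9)}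
    (hW : ∀ g, ∀ x ∈ W, formRep 1 g x ∈ W) {a b : Fin 9} {ψ : Delta9} (h : diff1 a b ψ ∈ W)
    (σ : Equiv.Perm (Fin 9)) : diff1 (σ a) (σ b) ψ ∈ W := by
  induction σ using Equiv.Perm.swap_induction_on with
  | one => exact h
  | swap_mul σ c d hcd ih =>
    have h1 := transposition_mem hW hcd ih
    rwa [diff1_apply, map_sub, transposition_form1, transposition_form1] at h1

/-- The argument for the sum-zero part of the permutation module: subtracting a transposed copy of a
vector of W leaves a difference of two indices, index permutations and spinor operators spread it,
and the differences span. -/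
lemma P_one_le {W : Submodule ℝ (Ext 1 V9 ⊗[ℝ] Delta9)}
    (hW : ∀ g, ∀ x ∈ W, formRep 1 g x ∈ W) (hle : W ≤ (P 1).toSubmodule) (hne : W ≠ ⊥) :
    (P 1).toSubmodule ≤ W := by
  obtain ⟨x, hx, hx0⟩ := Submodule.exists_mem_ne_zero_of_ne_bot hne
  obtain ⟨y, rfl⟩ := sum1_surjective x
  have hy := (sum1_mem_P_iff y).mp (hle hx)
  -- A constant family with zero sum satisfies 9 · y 0 = 0 and would vanish.
  obtain ⟨a, hya⟩ : ∃ a, y a ≠ y 0 := by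
    by_contra hcon
    push Not at hcon
    rw [Finset.sum_congr rfl fun a _ => hcon a, Finset.sum_const, Finset.card_univ,
      Fintype.card_fin, ← Nat.cast_smul_eq_nsmul ℝ, smul_eq_zero] at hy
    have h0 : y 0 = 0 := hy.resolve_left (by norm_num)
    refine hx0 ?_
    rw [sum1_apply]
    exact Finset.sum_eq_zero fun a _ => by rw [hcon a, h0, map_zero]
  have ha0 : a ≠ 0 := by
    rintro rfl
    exact hya rfl
  have hmem : diff1 a 0 (y a - y 0) ∈ W := by
    have h1 := sub_mem hx (transposition_mem hW ha0 hx)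
    rw [transposition_sum1, ← map_sub] at h1
    have h2 : (y - fun c => y (Equiv.swap a 0 c)) =
        Pi.single a (y a - y 0) - Pi.single 0 (y a - y 0) := by
      ext1 c
      by_cases hca : c = a
      · subst hca
        simp [ha0]
      · by_cases hc0 : c = 0
        · subst hc0
          simp [Ne.symm ha0]
        · simp [hca, hc0, Equiv.swap_apply_of_ne_of_ne]
    rwa [h2, map_sub, sum1_single, sum1_single] at h1
  have hall : ∀ φ, diff1 a 0 φ ∈ W := by
    refine forall_mem_of_mem hW (diff1 a 0) (fun c d hcd ψ => ?_) (sub_ne_zero.mpr hya) hmem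
    rw [diff1_apply, map_sub, formRep_halfTurn_form1 hcd, formRep_halfTurn_form1 hcd]
    rfl
  have hall' : ∀ b φ, diff1 b 0 φ ∈ W := by
    intro b φ
    by_cases hb : b = 0
    · rw [hb, diff1_apply, sub_self]
      exact zero_mem W
    · have h := diff1_perm_mem hW (hall φ) (Equiv.swap a b)
      rwa [Equiv.swap_apply_left, Equiv.swap_apply_of_ne_of_ne ha0.symm (Ne.symm hb)] at h
  intro x hx
  obtain ⟨y, rfl⟩ := sum1_surjective x
  have hy := (sum1_mem_P_iff y).mp hx
  have hsum : sum1 y = ∑ a, diff1 a 0 (y a) := by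
    simp only [diff1_apply, Finset.sum_sub_distrib]
    rw [← map_sum, hy, map_zero, sub_zero, sum1_apply]
  rw [hsum]
  exact sum_mem fun a _ => hall' a _

end VectorSpinors

/-! ### Irreducibility of P₂. -/

section TwoFormSpinors

lemma formRep_halfTurn_form2 {a b : Fin 9} (h : a ≠ b) (c d : Fin 9) (ψ : Delta9) :
    formRep 2 (halfTurn a b) (form2 (e c) (e d) ψ) =
      form2 (e c) (e d) (spinRep (halfTurn a b) ψ) := by
  rw [formRep_form2, vectorRep_halfTurn h, vectorRep_halfTurn h, form2_smul_smul,
    LinearMap.smul_apply]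
  split_ifs <;> norm_num

lemma transposition_form2 {a b : Fin 9} (h : a ≠ b) (c d : Fin 9) (ψ : Delta9) :
    transposition (formRep 2) a b h (form2 (e c) (e d) ψ) =
      form2 (e (Equiv.swap a b c)) (e (Equiv.swap a b d)) ψ := by
  refine transposition_apply h _ _ (formRep_halfTurn_form2 h c d) (fun ψ => ?_) ψ
  rw [formRep_form2, vectorRep_quarterTurn_swap, vectorRep_quarterTurn_swap, form2_smul_smul,
    LinearMap.smul_apply]
  split_ifs <;> norm_num

lemma transposition_sum2 {a b : Fin 9} (h : a ≠ b) (y : Fin 9 × Fin 9 → Delta9) :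
    transposition (formRep 2) a b h (sum2 y) =
      sum2 (fun t => y (Equiv.swap a b t.1, Equiv.swap a b t.2)) := by
  rw [sum2_apply, sum2_apply, map_sum]
  simp only [transposition_form2]
  exact Fintype.sum_equiv (Equiv.prodCongr (Equiv.swap a b) (Equiv.swap a b)) _ _ fun t => by
    simp

/-- A family of spinors indexed by pairs that is symmetric with zero diagonal. -/
structure IsGraphical {M : Type*} [Zero M] (y : Fin 9 × Fin 9 → M) : Prop where
  symm : ∀ a b, y (a, b) = y (b, a)
  diag : ∀ a, y (a, a) = 0

/-- Averaging over the two orders of a pair does not change `sum2`, and diagonal terms contribute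
nothing. -/
lemma exists_isGraphical_sum2_eq (x : Ext 2 V9 ⊗[ℝ] Delta9) :
    ∃ y, IsGraphical y ∧ sum2 y = x := by
  obtain ⟨z, rfl⟩ := sum2_surjective x
  refine ⟨fun t => if t.1 = t.2 then 0 else (2 : ℝ)⁻¹ • (z t + z t.swap), ⟨?_, ?_⟩, ?_⟩
  · intro a b
    simp only [Prod.swap_prod_mk, eq_comm (a := a), add_comm (z (a, b))]
  · intro a
    exact if_pos rfl
  · have h1 : sum2 (fun t => z t.swap) = sum2 z := by
      rw [sum2_apply, sum2_apply]
      refine Fintype.sum_equiv (Equiv.prodComm _ _) _ _ fun t => ?_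
      rw [form2_e_comm]
      rfl
    have h2 : sum2 (fun t => if t.1 = t.2 then 0 else (2 : ℝ)⁻¹ • (z t + z t.swap)) =
        sum2 ((2 : ℝ)⁻¹ • (z + fun t => z t.swap)) := by
      rw [sum2_apply, sum2_apply]
      refine Finset.sum_congr rfl fun t _ => ?_
      split_ifs with h
      · rw [h, form2_e_self]
        simp
      · rfl
    rw [h2, map_smul, map_add, h1]
    module

/-- Θ* becomes -2 times the row sums: over ordered pairs both endpoints give the same total, by
symmetry of y. -/
lemma sum2_mem_P_iff {y : Fin 9 × Fin 9 → Delta9} (hy : IsGraphical y) :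
    sum2 y ∈ (P 2).toSubmodule ↔ ∀ a, ∑ b, y (a, b) = 0 := by
  have h : thetaStar 1 (sum2 y) = sum1 ((-2 : ℝ) • fun a => ∑ b, y (a, b)) := by
    have h1 : ∀ t : Fin 9 × Fin 9, thetaStar 1 (form2 (e t.1) (e t.2) (y t)) =
        -(form1 (e t.1) (y t) + form1 (e t.2) (y t)) := by
      rintro ⟨a, b⟩
      by_cases hab : a = b
      · subst hab
        rw [hy.diag]
        simp
      · exact thetaStar_form2 hab _
    have h2 : ∑ a, form1 (e a) (∑ b, y (a, b)) = ∑ t : Fin 9 × Fin 9, form1 (e t.1) (y t) := by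
      rw [Fintype.sum_prod_type]
      exact Finset.sum_congr rfl fun a _ => map_sum _ _ _
    have h3 : ∑ a, form1 (e a) (∑ b, y (a, b)) = ∑ t : Fin 9 × Fin 9, form1 (e t.2) (y t) := by
      rw [Fintype.sum_prod_type_right]
      refine Finset.sum_congr rfl fun a _ => (map_sum _ _ _).trans ?_
      exact Finset.sum_congr rfl fun b _ => by rw [hy.symm]
    rw [sum2_apply, map_sum, Finset.sum_congr rfl fun t _ => h1 t, Finset.sum_neg_distrib,
      Finset.sum_add_distrib, ← h2, ← h3, map_smul, sum1_apply]
    module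
  change thetaStar 1 (sum2 y) = 0 ↔ _
  rw [h, map_eq_zero_iff _ sum1_injective, smul_eq_zero, funext_iff]
  simp

/-- The mixed difference of the spinor-valued forms `(e i ∧ e j) ⊗ (e i ⋆ (e j ⋆ ψ))` for `i` in
`{a, b}` and `j` in `{c, d}`. -/
def diff2 (a b c d : Fin 9) : Delta9 →ₗ[ℝ] Ext 2 V9 ⊗[ℝ] Delta9 :=
  form2 (e a) (e c) - form2 (e b) (e c) - (form2 (e a) (e d) - form2 (e b) (e d))

lemma diff2_apply (a b c d : Fin 9) (ψ : Delta9) :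
    diff2 a b c d ψ = form2 (e a) (e c) ψ - form2 (e b) (e c) ψ -
      (form2 (e a) (e d) ψ - form2 (e b) (e d) ψ) := rfl

lemma diff2_perm_mem {W : Submodule ℝ (Ext 2 V9 ⊗[ℝ] Delta9)}
    (hW : ∀ g, ∀ x ∈ W, formRep 2 g x ∈ W) {a b c d : Fin 9} {ψ : Delta9}
    (h : diff2 a b c d ψ ∈ W) (σ : Equiv.Perm (Fin 9)) :
    diff2 (σ a) (σ b) (σ c) (σ d) ψ ∈ W := by
  induction σ using Equiv.Perm.swap_induction_on with
  | one => exact h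
  | swap_mul σ i j hij ih =>
    have h1 := transposition_mem hW hij ih
    rwa [diff2_apply, map_sub, map_sub, map_sub, transposition_form2, transposition_form2,
      transposition_form2, transposition_form2] at h1

/-- Applying (1 - (a b))(1 - (c d)) to y leaves only the 4-cycle a, c, b, d with alternating
coefficients ±m. -/
lemma mixed_difference_eq {M : Type*} [AddCommGroup M] [Module ℝ M] {y : Fin 9 × Fin 9 → M}
    (hy : IsGraphical y) {a b c d : Fin 9} (hab : a ≠ b) (hac : a ≠ c) (had : a ≠ d) (hbc : b ≠ c)
    (hbd : b ≠ d) (hcd : c ≠ d) (m : M) (hm : m = y (a, c) - y (b, c) - (y (a, d) - y (b, d))) :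
    (fun t : Fin 9 × Fin 9 => y t - y (Equiv.swap a b t.1, Equiv.swap a b t.2) -
      (y (Equiv.swap c d t.1, Equiv.swap c d t.2) -
        y (Equiv.swap a b (Equiv.swap c d t.1), Equiv.swap a b (Equiv.swap c d t.2)))) =
      (Pi.single (a, c) m + Pi.single (c, a) m) - (Pi.single (b, c) m + Pi.single (c, b) m) -
        ((Pi.single (a, d) m + Pi.single (d, a) m) - (Pi.single (b, d) m + Pi.single (d, b) m)) := by
  let δ : Fin 9 → Fin 9 → ℝ := fun k i => if i = k then 1 else 0
  have hs : ∀ k l i j, (Pi.single (k, l) m : Fin 9 × Fin 9 → M) (i, j) = (δ k i * δ l j) • m := by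
    intro k l i j
    simp only [δ, Pi.single_apply, Prod.mk.injEq]
    by_cases h1 : i = k <;> by_cases h2 : j = l <;> simp [h1, h2]
  have hδ : ∀ k, δ k k = 1 := fun k => if_pos rfl
  have hδ' : ∀ {k i : Fin 9}, i ≠ k → δ k i = 0 := fun h => if_neg h
  have hw : ∀ {k l i : Fin 9}, i ≠ k → i ≠ l → Equiv.swap k l i = i :=
    fun h1 h2 => Equiv.swap_apply_of_ne_of_ne h1 h2
  have hsa := hw hac had
  have hsb := hw hbc hbd
  have hsc := hw hac.symm hbc.symm
  have hsd := hw had.symm hbd.symm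
  -- Only the position of an index relative to a, b, c, d matters: five cases for i and five for j.
  have hor : ∀ i,
      (δ a i = 1 ∧ δ b i = 0 ∧ δ c i = 0 ∧ δ d i = 0 ∧
      Equiv.swap a b i = b ∧ Equiv.swap c d i = a ∧ i = a) ∨
      (δ a i = 0 ∧ δ b i = 1 ∧ δ c i = 0 ∧ δ d i = 0 ∧
      Equiv.swap a b i = a ∧ Equiv.swap c d i = b ∧ i = b) ∨
      (δ a i = 0 ∧ δ b i = 0 ∧ δ c i = 1 ∧ δ d i = 0 ∧
      Equiv.swap a b i = c ∧ Equiv.swap c d i = d ∧ i = c) ∨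
      (δ a i = 0 ∧ δ b i = 0 ∧ δ c i = 0 ∧ δ d i = 1 ∧
      Equiv.swap a b i = d ∧ Equiv.swap c d i = c ∧ i = d) ∨
      (δ a i = 0 ∧ δ b i = 0 ∧ δ c i = 0 ∧ δ d i = 0 ∧
      Equiv.swap a b i = i ∧ Equiv.swap c d i = i ∧ i = i) := by
    intro i
    by_cases ha : i = a
    · subst ha
      simp [hδ, hδ', hab, hac, had, hsa]
    by_cases hb : i = b
    · subst hb
      simp [hδ, hδ', hab.symm, hbc, hbd, hsb]
    by_cases hc : i = c
    · subst hc
      simp [hδ, hδ', hac.symm, hbc.symm, hcd, hsc]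
    by_cases hd : i = d
    · subst hd
      simp [hδ, hδ', had.symm, hbd.symm, hcd.symm, hsd]
    simp [hδ' ha, hδ' hb, hδ' hc, hδ' hd, hw ha hb, hw hc hd]
  clear_value δ
  ext1 ⟨i, j⟩
  simp only [Pi.sub_apply, Pi.add_apply, hs]
  rcases hor i with ⟨h1, h2, h3, h4, h5, h6, h7⟩ | ⟨h1, h2, h3, h4, h5, h6, h7⟩ |
    ⟨h1, h2, h3, h4, h5, h6, h7⟩ | ⟨h1, h2, h3, h4, h5, h6, h7⟩ |
    ⟨h1, h2, h3, h4, h5, h6, h7⟩ <;>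
  rcases hor j with ⟨k1, k2, k3, k4, k5, k6, k7⟩ | ⟨k1, k2, k3, k4, k5, k6, k7⟩ |
    ⟨k1, k2, k3, k4, k5, k6, k7⟩ | ⟨k1, k2, k3, k4, k5, k6, k7⟩ |
    ⟨k1, k2, k3, k4, k5, k6, k7⟩ <;>
  rw [h1, h2, h3, h4, k1, k2, k3, k4] <;>
  simp only [h5, h6, k5, k6, Equiv.swap_apply_left, Equiv.swap_apply_right, hsc, hsd] <;>
  rw [h7, k7] <;>
  simp only [hy.diag, hy.symm b a, hy.symm c a, hy.symm d a, hy.symm c b, hy.symm d b,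
    hy.symm d c, hm] <;>
  module

lemma diff2_mem {W : Submodule ℝ (Ext 2 V9 ⊗[ℝ] Delta9)}
    (hW : ∀ g, ∀ x ∈ W, formRep 2 g x ∈ W) {y : Fin 9 × Fin 9 → Delta9} (hy : IsGraphical y)
    (hyW : sum2 y ∈ W) {a b c d : Fin 9} (hab : a ≠ b) (hac : a ≠ c) (had : a ≠ d) (hbc : b ≠ c)
    (hbd : b ≠ d) (hcd : c ≠ d) :
    diff2 a b c d (y (a, c) - y (b, c) - (y (a, d) - y (b, d))) ∈ W := by
  have h1 := sub_mem hyW (transposition_mem hW hab hyW)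
  have h2 := sub_mem h1 (transposition_mem hW hcd h1)
  rw [map_sub, transposition_sum2, transposition_sum2, transposition_sum2] at h2
  have h3 := congrArg sum2 (mixed_difference_eq hy hab hac had hbc hbd hcd _ rfl)
  generalize y (a, c) - y (b, c) - (y (a, d) - y (b, d)) = m at h3 ⊢
  simp only [map_add, map_sub, sum2_single] at h3
  rw [form2_e_comm c a, form2_e_comm c b, form2_e_comm d a, form2_e_comm d b, sum2_apply] at h3
  -- The factor 2 comes from the two orders of each edge.
  have h4 : (2 : ℝ) • diff2 a b c d m ∈ W := by
    rw [diff2_apply]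
    convert h2 using 1
    simp only [sum2_apply, ← Finset.sum_sub_distrib, ← map_sub]
    rw [h3]
    module
  exact (W.smul_mem_iff two_ne_zero).mp h4

/-- The defect F a c - F 0 a - F 0 c is the same for all distinct nonzero a, c, which leaves one
constant to absorb. It is applied both to spinor coefficients and, dually, to linear maps into a
quotient. -/
lemma exists_eq_add_of_mixed_difference {M : Type*} [AddCommGroup M] [Module ℝ M]
    (F : Fin 9 → Fin 9 → M) (hsymm : ∀ a b, F a b = F b a)
    (h : ∀ a b c d, a ≠ b → a ≠ c → a ≠ d → b ≠ c → b ≠ d → c ≠ d →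
      F a c - F b c - (F a d - F b d) = 0) :
    ∃ f : Fin 9 → M, ∀ a b, a ≠ b → F a b = f a + f b := by
  have hstep : ∀ a c d, a ≠ 0 → c ≠ 0 → d ≠ 0 → a ≠ c → a ≠ d →
      F a c - F 0 a - F 0 c = F a d - F 0 a - F 0 d := by
    intro a c d ha hc hd hac had
    by_cases hcd : c = d
    · rw [hcd]
    · have := h a 0 c d ha hac had hc.symm hd.symm hcd
      rw [sub_right_comm, sub_right_comm (F a d), sub_eq_zero.mp this]
  have hswap : ∀ a c, F a c - F 0 a - F 0 c = F c a - F 0 c - F 0 a := by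
    intro a c
    rw [hsymm a c, sub_right_comm]
  have hconst : ∀ a c, a ≠ 0 → c ≠ 0 → a ≠ c →
      F a c - F 0 a - F 0 c = F 1 2 - F 0 1 - F 0 2 := by
    intro a c ha hc hac
    by_cases ha1 : a = 1
    · subst ha1
      exact hstep 1 c 2 (by decide) hc (by decide) hac (by decide)
    · rw [hstep a c 1 ha hc (by decide) hac ha1, hswap,
        hstep 1 a 2 (by decide) ha (by decide) (Ne.symm ha1) (by decide)]
  -- The value f 0 is forced by the three equations on the triangle 0, 1, 2.
  let f0 : M := (2 : ℝ)⁻¹ • (F 0 1 + F 0 2 - F 1 2)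
  refine ⟨fun c => if c = 0 then f0 else F 0 c - f0, fun a b hab => ?_⟩
  by_cases ha : a = 0
  · subst ha
    simp [hab.symm]
  · by_cases hb : b = 0
    · subst hb
      simp [ha, hsymm a 0]
    · have hG := hconst a b ha hb hab
      have hF : F a b = F 1 2 - F 0 1 - F 0 2 + F 0 a + F 0 b := by
        rw [← hG]
        abel
      simp only [ha, hb, if_false, f0]
      rw [hF]
      module

lemma eq_zero_of_mixed_difference {M : Type*} [AddCommGroup M] [Module ℝ M]
    {y : Fin 9 × Fin 9 → M} (hy : IsGraphical y) (hrow : ∀ a, ∑ b, y (a, b) = 0)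
    (h : ∀ a b c d, a ≠ b → a ≠ c → a ≠ d → b ≠ c → b ≠ d → c ≠ d →
      y (a, c) - y (b, c) - (y (a, d) - y (b, d)) = 0) : y = 0 := by
  obtain ⟨u, hu⟩ := exists_eq_add_of_mixed_difference (fun a b => y (a, b)) hy.symm h
  -- Row a sums to 8 u a plus the total without u a. Summing over a then gives (7 + 9) ∑ u = 0.
  have h7 : ∀ a, (7 : ℝ) • u a + ∑ b, u b = 0 := by
    intro a
    have h1 : ∀ b, y (a, b) = u a + u b - if b = a then (2 : ℝ) • u a else 0 := by
      intro b
      split_ifs with hba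
      · rw [hba, hy.diag]
        module
      · rw [sub_zero]
        exact hu a b (Ne.symm hba)
    have h2 := hrow a
    rw [Finset.sum_congr rfl fun b _ => h1 b, Finset.sum_sub_distrib, Finset.sum_add_distrib,
      Finset.sum_const, Finset.card_univ, Fintype.card_fin, Finset.sum_ite_eq'] at h2
    rw [← h2, if_pos (Finset.mem_univ a)]
    module
  have hU : ∑ b, u b = 0 := by
    have h1 := Finset.sum_eq_zero (s := Finset.univ) fun a _ => h7 a
    rw [Finset.sum_add_distrib, ← Finset.smul_sum, Finset.sum_const, Finset.card_univ,
      Fintype.card_fin] at h1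
    have h2 : (16 : ℝ) • ∑ b, u b = 0 := by
      rw [← h1]
      module
    exact (smul_eq_zero.mp h2).resolve_left (by norm_num)
  have hu0 : ∀ a, u a = 0 := by
    intro a
    have := h7 a
    rw [hU, add_zero] at this
    exact (smul_eq_zero.mp this).resolve_left (by norm_num)
  ext1 ⟨a, b⟩
  by_cases hab : a = b
  · rw [hab, hy.diag]
    rfl
  · rw [hu a b hab, hu0, hu0, add_zero]
    rfl

/-- A nonzero element of P₂ has a nonzero mixed difference, so W contains one alternating 4-cycle,
hence all of them with all spinors; duality through the quotient by W shows that these span P₂. -/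
lemma P_two_le {W : Submodule ℝ (Ext 2 V9 ⊗[ℝ] Delta9)}
    (hW : ∀ g, ∀ x ∈ W, formRep 2 g x ∈ W) (hle : W ≤ (P 2).toSubmodule) (hne : W ≠ ⊥) :
    (P 2).toSubmodule ≤ W := by
  obtain ⟨x, hx, hx0⟩ := Submodule.exists_mem_ne_zero_of_ne_bot hne
  obtain ⟨y, hy, rfl⟩ := exists_isGraphical_sum2_eq x
  have hrow := (sum2_mem_P_iff hy).mp (hle hx)
  obtain ⟨a, b, c, d, hab, hac, had, hbc, hbd, hcd, hm⟩ : ∃ a b c d, a ≠ b ∧ a ≠ c ∧ a ≠ d ∧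
      b ≠ c ∧ b ≠ d ∧ c ≠ d ∧ y (a, c) - y (b, c) - (y (a, d) - y (b, d)) ≠ 0 := by
    by_contra hcon
    push Not at hcon
    refine hx0 ?_
    rw [eq_zero_of_mixed_difference hy hrow hcon, map_zero]
  have hall : ∀ φ, diff2 a b c d φ ∈ W := by
    refine forall_mem_of_mem hW (diff2 a b c d) (fun i j hij ψ => ?_) hm
      (diff2_mem hW hy hx hab hac had hbc hbd hcd)
    rw [diff2_apply]
    simp only [map_sub, formRep_halfTurn_form2 hij]
    rfl
  have hall' : ∀ a' b' c' d', a' ≠ b' → a' ≠ c' → a' ≠ d' → b' ≠ c' → b' ≠ d' → c' ≠ d' →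
      ∀ φ, diff2 a' b' c' d' φ ∈ W := by
    intro a' b' c' d' hab' hac' had' hbc' hbd' hcd' φ
    have hinj : ∀ {p q r s : Fin 9}, p ≠ q → p ≠ r → p ≠ s → q ≠ r → q ≠ s → r ≠ s →
        Function.Injective ![p, q, r, s] := by
      intro p q r s _ _ _ _ _ _ i j hij
      fin_cases i <;> fin_cases j <;> simp_all
    obtain ⟨σ, hσ⟩ := (Equiv.Perm.isMultiplyPretransitive (Fin 9) 4).exists_smul_eq
      ⟨_, hinj hab hac had hbc hbd hcd⟩ ⟨_, hinj hab' hac' had' hbc' hbd' hcd'⟩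
    have h := diff2_perm_mem hW (hall φ) σ
    have h0 : σ a = a' := DFunLike.congr_fun hσ 0
    have h1 : σ b = b' := DFunLike.congr_fun hσ 1
    have h2 : σ c = c' := DFunLike.congr_fun hσ 2
    have h3 : σ d = d' := DFunLike.congr_fun hσ 3
    rwa [h0, h1, h2, h3] at h
  -- Modulo W all mixed differences of the edge forms vanish, so an edge form is a sum of two vertex
  -- terms. On an element of P₂ these are evaluated at row sums, which are zero.
  obtain ⟨f, hf⟩ := exists_eq_add_of_mixed_difference
    (fun a b => W.mkQ ∘ₗ form2 (e a) (e b)) (fun a b => by rw [form2_e_comm]) (by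
      intro a b c d hab hac had hbc hbd hcd
      ext1 φ
      have h := (Submodule.Quotient.mk_eq_zero W).mpr (hall' a b c d hab hac had hbc hbd hcd φ)
      rw [← Submodule.mkQ_apply, diff2_apply] at h
      simpa using h)
  intro x hx
  obtain ⟨z, hz, rfl⟩ := exists_isGraphical_sum2_eq x
  have hzrow := (sum2_mem_P_iff hz).mp hx
  rw [← Submodule.Quotient.mk_eq_zero, ← Submodule.mkQ_apply, sum2_apply, map_sum]
  have h1 : ∀ t : Fin 9 × Fin 9, W.mkQ (form2 (e t.1) (e t.2) (z t)) =
      f t.1 (z t) + f t.2 (z t) := by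
    rintro ⟨a, b⟩
    by_cases hab : a = b
    · subst hab
      rw [hz.diag]
      simp
    · exact LinearMap.congr_fun (hf a b hab) _
  rw [Finset.sum_congr rfl fun t _ => h1 t, Finset.sum_add_distrib, Fintype.sum_prod_type,
    Fintype.sum_prod_type_right]
  have h2 : ∀ a, ∑ b, f a (z (a, b)) = 0 := fun a => by rw [← map_sum, hzrow, map_zero]
  have h3 : ∀ a, ∑ b, f a (z (b, a)) = 0 := fun a => by
    rw [← h2 a]
    exact Finset.sum_congr rfl fun b _ => by rw [hz.symm]
  simp [h2, h3]

end TwoFormSpinors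

/-! ### Invariant inner products and contractions over orthonormal bases. -/

section Orthogonality

/-- Conjugation preserves the scalar v · v = -⟨v, v⟩; polarisation gives the inner product. -/
lemma inner_vectorRep (g : Spin9) (v w : V9) :
    inner ℝ (vectorRep g v) (vectorRep g w) = (inner ℝ v w : ℝ) := by
  have hnorm : ∀ v, inner ℝ (vectorRep g v) (vectorRep g v) = (inner ℝ v v : ℝ) := by
    intro v
    have h : CliffordAlgebra.ι Q9 (vectorRep g v) * CliffordAlgebra.ι Q9 (vectorRep g v) =
        CliffordAlgebra.ι Q9 v * CliffordAlgebra.ι Q9 v := by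
      change CliffordAlgebra.ι Q9 (vectorMap g v) * CliffordAlgebra.ι Q9 (vectorMap g v) = _
      have h1 : star (g : CliffordAlgebra Q9) * ((g : CliffordAlgebra Q9) *
          (CliffordAlgebra.ι Q9 v * star (g : CliffordAlgebra Q9))) =
          CliffordAlgebra.ι Q9 v * star (g : CliffordAlgebra Q9) := by
        rw [← mul_assoc, spinGroup.coe_star_mul_self, one_mul]
      rw [ι_vectorMap, mul_assoc, mul_assoc, mul_assoc, h1, ← mul_assoc (CliffordAlgebra.ι Q9 v),
        CliffordAlgebra.ι_sq_scalar, Algebra.left_comm,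
        spinGroup.mul_star_self_of_mem g.2, mul_one]
    rw [CliffordAlgebra.ι_sq_scalar, CliffordAlgebra.ι_sq_scalar] at h
    exact neg_injective (algebraMap_Q9_injective h)
  have h := hnorm (v + w)
  simp only [map_add, inner_add_left, inner_add_right, hnorm] at h
  rw [real_inner_comm (vectorRep g v), real_inner_comm v w] at h
  linarith

lemma J_isSymmetric (a : Fin 9) : (J a).IsSymmetric := by
  rw [J_eq, Matrix.isSymmetric_toEuclideanLin_iff, Matrix.IsHermitian,
    Matrix.conjTranspose_eq_transpose_of_trivial, I_transpose]

lemma starMul_isSymmetric (v : V9) : (starMul v).IsSymmetric := by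
  intro φ ψ
  simp only [starMul_apply, LinearMap.sum_apply, LinearMap.smul_apply, sum_inner, inner_sum,
    inner_smul_left, inner_smul_right, conj_trivial]
  refine Finset.sum_congr rfl fun a _ => ?_
  rw [← J_eq, J_isSymmetric]

/-- Clifford multiplications are symmetric, so the adjoint reverses products as `star` does; the
signs of `star` on vectors cancel in pairs. The witness y carries the evenness of `star x` through
the induction. -/
lemma evenAction_star (x : CliffordAlgebra.even Q9) :
    ∃ y : CliffordAlgebra.even Q9, (y : CliffordAlgebra Q9) = star (x : CliffordAlgebra Q9) ∧
      ∀ φ ψ, inner ℝ (evenAction x φ) ψ = (inner ℝ φ (evenAction y ψ) : ℝ) := by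
  suffices h : ∀ (z : CliffordAlgebra Q9) (hz : z ∈ CliffordAlgebra.evenOdd Q9 0),
      ∀ x : CliffordAlgebra.even Q9, (x : CliffordAlgebra Q9) = z →
      ∃ y : CliffordAlgebra.even Q9, (y : CliffordAlgebra Q9) = star z ∧
      ∀ φ ψ, inner ℝ (evenAction x φ) ψ = (inner ℝ φ (evenAction y ψ) : ℝ) from
    h x x.2 x rfl
  intro z hz
  induction z, hz using CliffordAlgebra.even_induction with
  | algebraMap r =>
    intro x hx
    have h : x = algebraMap ℝ (CliffordAlgebra.even Q9) r := Subtype.ext hx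
    refine ⟨x, ?_, fun φ ψ => ?_⟩
    · rw [hx, CliffordAlgebra.star_algebraMap]
    · rw [h, AlgHom.commutes, Module.algebraMap_end_apply, Module.algebraMap_end_apply,
        inner_smul_left, inner_smul_right, conj_trivial]
  | add u v hu hv ihu ihv =>
    intro x hx
    obtain ⟨y1, h1, h1'⟩ := ihu ⟨u, hu⟩ rfl
    obtain ⟨y2, h2, h2'⟩ := ihv ⟨v, hv⟩ rfl
    have h : x = ⟨u, hu⟩ + ⟨v, hv⟩ := Subtype.ext hx
    refine ⟨y1 + y2, ?_, fun φ ψ => ?_⟩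
    · rw [star_add, ← h1, ← h2]
      rfl
    · rw [h, map_add, map_add, LinearMap.add_apply, LinearMap.add_apply, inner_add_left,
        inner_add_right, h1', h2']
  | ι_mul_ι_mul u v w hw ih =>
    intro x hx
    obtain ⟨y, h1, h1'⟩ := ih ⟨w, hw⟩ rfl
    have h : x = (CliffordAlgebra.even.ι Q9).bilin u v * ⟨w, hw⟩ := Subtype.ext hx
    refine ⟨y * (CliffordAlgebra.even.ι Q9).bilin v u, ?_, fun φ ψ => ?_⟩
    · rw [star_mul, star_mul, CliffordAlgebra.star_ι, CliffordAlgebra.star_ι, neg_mul_neg, ← h1]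
      rfl
    · rw [h, map_mul, map_mul, evenAction_ι_mul_ι, evenAction_ι_mul_ι, Module.End.mul_apply,
        Module.End.mul_apply, ← h1', LinearMap.neg_apply, LinearMap.neg_apply, inner_neg_left,
        inner_neg_right, Module.End.mul_apply, Module.End.mul_apply, starMul_isSymmetric,
        starMul_isSymmetric]

lemma inner_spinRep (g : Spin9) (φ ψ : Delta9) :
    inner ℝ (spinRep g φ) (spinRep g ψ) = (inner ℝ φ ψ : ℝ) := by
  obtain ⟨y, hy, hy'⟩ := evenAction_star ⟨g, spinGroup.mem_even g.2⟩
  have h1 : y * ⟨g, spinGroup.mem_even g.2⟩ = 1 := by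
    apply Subtype.ext
    change (y : CliffordAlgebra Q9) * (g : CliffordAlgebra Q9) = 1
    rw [hy]
    exact spinGroup.coe_star_mul_self g
  change inner ℝ (evenAction ⟨g, _⟩ φ) (evenAction ⟨g, _⟩ ψ) = _
  rw [hy', ← Module.End.mul_apply, ← map_mul, h1, map_one, Module.End.one_apply]

variable {E ι M : Type*} [NormedAddCommGroup E] [InnerProductSpace ℝ E] [Fintype ι]
  [AddCommGroup M] [Module ℝ M]

/-- Both sides expand to the same double sum over b and b'. Two bases are allowed so that A = B = id
yields independence of the basis. -/
lemma sum_bilin_adjoint (b b' : OrthonormalBasis ι ℝ E) (C : E →ₗ[ℝ] E →ₗ[ℝ] M)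
    (A B : E →ₗ[ℝ] E) (h : ∀ x y, inner ℝ (A x) y = (inner ℝ x (B y) : ℝ)) :
    ∑ i, C (A (b i)) (b i) = ∑ i, C (b' i) (B (b' i)) := by
  classical
  have h1 : ∀ i, C (A (b i)) (b i) =
      ∑ j, (inner ℝ (b' j) (A (b i)) : ℝ) • C (b' j) (b i) := by
    intro i
    nth_rewrite 1 [← b'.sum_repr' (A (b i))]
    simp only [map_sum, map_smul, LinearMap.sum_apply, LinearMap.smul_apply]
  have h2 : ∀ j, C (b' j) (B (b' j)) =
      ∑ i, (inner ℝ (b i) (B (b' j)) : ℝ) • C (b' j) (b i) := by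
    intro j
    nth_rewrite 1 [← b.sum_repr' (B (b' j))]
    simp only [map_sum, map_smul]
  simp only [h1, h2]
  rw [Finset.sum_comm]
  refine Finset.sum_congr rfl fun j _ => Finset.sum_congr rfl fun i _ => ?_
  rw [← h, real_inner_comm]

lemma sum_bilin_isometry (b : OrthonormalBasis ι ℝ E) (C : E →ₗ[ℝ] E →ₗ[ℝ] M) (g : E →ₗ[ℝ] E)
    (hg : ∀ x y, inner ℝ (g x) (g y) = (inner ℝ x y : ℝ)) :
    ∑ i, C (g (b i)) (g (b i)) = ∑ i, C (b i) (b i) := by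
  have := b.toBasis.finiteDimensional_of_finite
  let g' : E ≃ₗᵢ[ℝ] E := (g.isometryOfInner hg).toLinearIsometryEquiv rfl
  exact sum_bilin_adjoint (b.map g') b C LinearMap.id LinearMap.id fun _ _ => rfl

lemma sum_bilin_isSymmetric (b : OrthonormalBasis ι ℝ E) (C : E →ₗ[ℝ] E →ₗ[ℝ] M)
    (hC : ∀ x, C x x = 0) (A : E →ₗ[ℝ] E) (hA : A.IsSymmetric) : ∑ i, C (b i) (A (b i)) = 0 := by
  have hanti : ∀ x y, C x y = -C y x := by
    intro x y
    have h := hC (x + y)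
    simp only [map_add, LinearMap.add_apply, hC, zero_add, add_zero] at h
    exact eq_neg_of_add_eq_zero_right h
  have h1 := sum_bilin_adjoint b b C A A hA
  rw [Finset.sum_congr rfl fun i _ => hanti (A (b i)) (b i), Finset.sum_neg_distrib] at h1
  have h2 : (2 : ℝ) • ∑ i, C (b i) (A (b i)) = 0 := by
    rw [two_smul]
    nth_rewrite 1 [← h1]
    exact neg_add_cancel _
  exact (smul_eq_zero.mp h2).resolve_left two_ne_zero

end Orthogonality

/-! ### Bivectors and trivectors attached to operators on Δ₉. -/

section SpinorWedge

lemma update_three_one {V : Type*} (x y z w : V) : Function.update ![x, y, z] 1 w = ![x, w, z] := by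
  ext1 i
  fin_cases i <;> rfl

lemma update_three_two {V : Type*} (x y z w : V) : Function.update ![x, y, z] 2 w = ![x, y, w] := by
  ext1 i
  fin_cases i <;> rfl

variable {V : Type} [AddCommGroup V] [Module ℝ V]

/-- The wedge product of two vectors as a bilinear map. -/
def wedge2 : V →ₗ[ℝ] V →ₗ[ℝ] Ext 2 V :=
  LinearMap.mk₂ ℝ (fun x y => wedge 2 ![x, y])
    (fun x x' y => (wedge 2).toMultilinearMap.cons_add ![y] x x')
    (fun c x y => (wedge 2).toMultilinearMap.cons_smul ![y] c x)
    (fun x y y' => by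
      rw [wedge_two_swap, wedge_two_swap y, wedge_two_swap y', ← neg_add]
      exact congrArg Neg.neg ((wedge 2).toMultilinearMap.cons_add ![x] y y'))
    (fun c x y => by
      rw [wedge_two_swap, wedge_two_swap y, smul_neg]
      exact congrArg Neg.neg ((wedge 2).toMultilinearMap.cons_smul ![x] c y))

lemma wedge2_apply (x y : V) : wedge2 x y = wedge 2 ![x, y] := rfl

/-- The wedge product of three vectors as a trilinear map. -/
def wedge3 : V →ₗ[ℝ] V →ₗ[ℝ] V →ₗ[ℝ] Ext 3 V :=
  LinearMap.mk₂ ℝ (fun x y =>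
      { toFun := fun z => wedge 3 ![x, y, z]
        map_add' := fun z z' => by
          have := (wedge (V := V) 3).map_update_add ![x, y, z] 2 z z'
          simpa only [update_three_two] using this
        map_smul' := fun c z => by
          have := (wedge (V := V) 3).map_update_smul ![x, y, z] 2 c z
          simpa only [update_three_two, RingHom.id_apply] using this })
    (fun x x' y => LinearMap.ext fun z => (wedge 3).toMultilinearMap.cons_add ![y, z] x x')
    (fun c x y => LinearMap.ext fun z => (wedge 3).toMultilinearMap.cons_smul ![y, z] c x)
    (fun x y y' => LinearMap.ext fun z => by
      have := (wedge (V := V) 3).map_update_add ![x, y, z] 1 y y'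
      simp only [update_three_one] at this
      exact this)
    (fun c x y => LinearMap.ext fun z => by
      have := (wedge (V := V) 3).map_update_smul ![x, y, z] 1 c y
      simp only [update_three_one] at this
      exact this)

lemma wedge3_apply (x y z : V) : wedge3 x y z = wedge 3 ![x, y, z] := rfl

lemma extMap_wedge2 (f : V →ₗ[ℝ] V) (x y : V) : extMap 2 f (wedge2 x y) = wedge2 (f x) (f y) := by
  rw [wedge2_apply, wedge2_apply, extMap_wedge]
  congr 1
  ext1 i
  fin_cases i <;> rfl

lemma extMap_wedge3 (f : V →ₗ[ℝ] V) (x y z : V) :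
    extMap 3 f (wedge3 x y z) = wedge3 (f x) (f y) (f z) := by
  rw [wedge3_apply, wedge3_apply, extMap_wedge]
  congr 1
  ext1 i
  fin_cases i <;> rfl

/-- The standard orthonormal basis of `Δ₉`. -/
abbrev spinorBasis : OrthonormalBasis SpinorIndex ℝ Delta9 := EuclideanSpace.basisFun SpinorIndex ℝ

/-- The bivector `∑ i, ε i ∧ A (ε i)` of an operator `A` on `Δ₉`. -/
def opWedge2 : Module.End ℝ Delta9 →ₗ[ℝ] Ext 2 Delta9 :=
  ∑ i, wedge2 (spinorBasis i) ∘ₗ LinearMap.applyₗ (spinorBasis i)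

lemma opWedge2_apply (A : Module.End ℝ Delta9) :
    opWedge2 A = ∑ i, wedge2 (spinorBasis i) (A (spinorBasis i)) := by
  simp [opWedge2]

/-- The trivector `∑ i, ε i ∧ A (ε i) ∧ φ`. -/
def opWedge3 : Module.End ℝ Delta9 →ₗ[ℝ] Delta9 →ₗ[ℝ] Ext 3 Delta9 :=
  ∑ i, wedge3 (spinorBasis i) ∘ₗ LinearMap.applyₗ (spinorBasis i)

lemma opWedge3_apply (A : Module.End ℝ Delta9) (φ : Delta9) :
    opWedge3 A φ = ∑ i, wedge3 (spinorBasis i) (A (spinorBasis i)) φ := by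
  simp [opWedge3]

/-- The spin representation is orthogonal, so the basis ε_i may be replaced by its image under g. -/
lemma opWedge2_equivariant (g : Spin9) {A A' : Module.End ℝ Delta9}
    (h : ∀ ψ, A' (spinRep g ψ) = spinRep g (A ψ)) :
    extRep 2 spinRep g (opWedge2 A) = opWedge2 A' := by
  change extMap 2 (spinRep g) (opWedge2 A) = _
  rw [opWedge2_apply, opWedge2_apply, map_sum]
  have h1 := sum_bilin_isometry spinorBasis (wedge2.compl₂ A') (spinRep g) (inner_spinRep g)
  simp only [LinearMap.compl₂_apply] at h1
  rw [← h1]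
  exact Finset.sum_congr rfl fun i _ => by rw [extMap_wedge2, ← h]

lemma opWedge3_equivariant (g : Spin9) {A A' : Module.End ℝ Delta9}
    (h : ∀ ψ, A' (spinRep g ψ) = spinRep g (A ψ)) (φ : Delta9) :
    extRep 3 spinRep g (opWedge3 A φ) = opWedge3 A' (spinRep g φ) := by
  change extMap 3 (spinRep g) (opWedge3 A φ) = _
  rw [opWedge3_apply, opWedge3_apply, map_sum]
  have h1 := sum_bilin_isometry spinorBasis (wedge3.compl₂ A') (spinRep g) (inner_spinRep g)
  have h2 := LinearMap.congr_fun h1 (spinRep g φ)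
  simp only [LinearMap.sum_apply, LinearMap.compl₂_apply] at h2
  rw [← h2]
  exact Finset.sum_congr rfl fun i _ => by rw [extMap_wedge3, ← h]

lemma opWedge2_of_isSymmetric {A : Module.End ℝ Delta9} (hA : A.IsSymmetric) : opWedge2 A = 0 := by
  rw [opWedge2_apply]
  exact sum_bilin_isSymmetric spinorBasis wedge2
    (fun x => (wedge 2).map_eq_zero_of_eq _ (i := 0) (j := 1) rfl (by decide)) A hA

lemma opWedge3_of_isSymmetric {A : Module.End ℝ Delta9} (hA : A.IsSymmetric) : opWedge3 A = 0 := by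
  ext1 φ
  have h := sum_bilin_isSymmetric spinorBasis wedge3
    (fun x => LinearMap.ext fun y =>
      (wedge 3).map_eq_zero_of_eq _ (i := 0) (j := 1) rfl (by decide)) A hA
  have h2 := LinearMap.congr_fun h φ
  rw [LinearMap.sum_apply] at h2
  rw [opWedge3_apply]
  exact h2

end SpinorWedge

/-! ### Clifford products as alternating maps modulo symmetric operators. -/

section CliffordLift

lemma starMul_starMul_self (v : V9) (φ : Delta9) :
    starMul v (starMul v φ) = (inner ℝ v v : ℝ) • φ := by
  have h := LinearMap.congr_fun (starMul_mul_self v) φ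
  rw [Module.End.mul_apply, Module.algebraMap_end_apply] at h
  rw [h]
  congr 1

variable {M : Type*} [AddCommGroup M] [Module ℝ M]

/-- The multilinear map `(v₁, …, v_k) ↦ B (v₁ ⋆ ⋯ ⋆ v_k ⋆ ·)`. -/
def cliffordMultilinear (k : ℕ) (B : Module.End ℝ Delta9 →ₗ[ℝ] M) :
    MultilinearMap ℝ (fun _ : Fin k => V9) M :=
  B.compMultilinearMap
    ((MultilinearMap.mkPiAlgebraFin ℝ k (Module.End ℝ Delta9)).compLinearMap fun _ => starMul)

/-- The linear map `v ∧ w ↦ B (v ⋆ (w ⋆ ·))` for a map `B` that kills the symmetric operators. -/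
def lift2 (B : Module.End ℝ Delta9 →ₗ[ℝ] M)
    (hB : ∀ A : Module.End ℝ Delta9, A.IsSymmetric → B A = 0) :
    Ext 2 V9 →ₗ[ℝ] M :=
  exteriorPower.alternatingMapLinearEquiv
    { cliffordMultilinear 2 B with
      map_eq_zero_of_eq' := by
        intro v i j hij hne
        have h01 : v 0 = v 1 := by
          fin_cases i <;> fin_cases j <;> simp_all
        refine hB _ fun φ ψ => ?_
        simp [List.ofFn_succ, h01]
        rw [starMul_isSymmetric, starMul_isSymmetric] }

lemma lift2_wedge (B : Module.End ℝ Delta9 →ₗ[ℝ] M) (hB) (v : Fin 2 → V9) :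
    lift2 B hB (wedge 2 v) = B (starMul (v 0) * starMul (v 1)) := by
  refine (exteriorPower.alternatingMapLinearEquiv_apply_ιMulti _ _).trans ?_
  change B _ = _
  simp [List.ofFn_succ]

/-- The linear map `u ∧ v ∧ w ↦ B (u ⋆ (v ⋆ (w ⋆ ·)))` for a map `B` that kills the symmetric
operators. -/
def lift3 (B : Module.End ℝ Delta9 →ₗ[ℝ] M)
    (hB : ∀ A : Module.End ℝ Delta9, A.IsSymmetric → B A = 0) :
    Ext 3 V9 →ₗ[ℝ] M :=
  exteriorPower.alternatingMapLinearEquiv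
    { cliffordMultilinear 3 B with
      map_eq_zero_of_eq' := by
        intro v i j hij hne
        have hor : v 0 = v 1 ∨ v 0 = v 2 ∨ v 1 = v 2 := by
          fin_cases i <;> fin_cases j <;> simp_all
        -- The adjoint is the product in reverse order. An adjacent equal pair collapses to a
        -- scalar, and equal outer factors make the product a palindrome, so the operator is
        -- symmetric in every case.
        refine hB _ fun φ ψ => ?_
        simp [List.ofFn_succ]
        rw [starMul_isSymmetric, starMul_isSymmetric, starMul_isSymmetric]
        rcases hor with h | h | h
        · rw [h, starMul_starMul_self, starMul_starMul_self, map_smul]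
        · rw [h]
        · rw [h, starMul_starMul_self, starMul_starMul_self, map_smul] }

lemma lift3_wedge (B : Module.End ℝ Delta9 →ₗ[ℝ] M) (hB) (v : Fin 3 → V9) :
    lift3 B hB (wedge 3 v) = B (starMul (v 0) * (starMul (v 1) * starMul (v 2))) := by
  refine (exteriorPower.alternatingMapLinearEquiv_apply_ιMulti _ _).trans ?_
  change B _ = _
  simp [List.ofFn_succ]

end CliffordLift

/-! ### The equivariant maps into Λ²(Δ₉) and Λ³(Δ₉). -/

section IntertwiningMaps

lemma ext_wedge {k : ℕ} {M : Type*} [AddCommGroup M] [Module ℝ M] {f g : Ext k V9 →ₗ[ℝ] M}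
    (h : ∀ v, f (wedge k v) = g (wedge k v)) : f = g := by
  refine (extBasis k).ext fun S => ?_
  rw [extBasis_apply, h]

/-- The map `v ∧ w ↦ ∑ i, ε i ∧ v ⋆ w ⋆ ε i`. -/
def twoFormsToBivectors : (extRep 2 vectorRep).IntertwiningMap (extRep 2 spinRep) where
  toLinearMap := lift2 opWedge2 fun _ => opWedge2_of_isSymmetric
  isIntertwining' g := by
    refine ext_wedge fun v => ?_
    rw [LinearMap.comp_apply, LinearMap.comp_apply, extRep_wedge, lift2_wedge, lift2_wedge]
    refine (opWedge2_equivariant g fun ψ => ?_).symm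
    rw [Module.End.mul_apply, Module.End.mul_apply, spinRep_starMul, spinRep_starMul]

lemma twoFormsToBivectors_wedge (v : Fin 2 → V9) :
    twoFormsToBivectors (wedge 2 v) = opWedge2 (starMul (v 0) * starMul (v 1)) :=
  lift2_wedge _ (fun _ => opWedge2_of_isSymmetric) v

/-- The map `u ∧ v ∧ w ↦ ∑ i, ε i ∧ u ⋆ v ⋆ w ⋆ ε i`. -/
def threeFormsToBivectors : (extRep 3 vectorRep).IntertwiningMap (extRep 2 spinRep) where
  toLinearMap := lift3 opWedge2 fun _ => opWedge2_of_isSymmetric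
  isIntertwining' g := by
    refine ext_wedge fun v => ?_
    rw [LinearMap.comp_apply, LinearMap.comp_apply, extRep_wedge, lift3_wedge, lift3_wedge]
    refine (opWedge2_equivariant g fun ψ => ?_).symm
    simp only [Module.End.mul_apply, spinRep_starMul]

lemma threeFormsToBivectors_wedge (v : Fin 3 → V9) :
    threeFormsToBivectors (wedge 3 v) =
      opWedge2 (starMul (v 0) * (starMul (v 1) * starMul (v 2))) :=
  lift3_wedge _ (fun _ => opWedge2_of_isSymmetric) v

/-- The map `(v ∧ w) ⊗ φ ↦ ∑ i, ε i ∧ v ⋆ w ⋆ ε i ∧ φ`. -/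
def twoFormsToTrivectors : (formRep 2).IntertwiningMap (extRep 3 spinRep) where
  toLinearMap := TensorProduct.lift (lift2 opWedge3 fun _ => opWedge3_of_isSymmetric)
  isIntertwining' g := by
    refine TensorProduct.ext ?_
    refine ext_wedge fun v => ?_
    ext1 φ
    change TensorProduct.lift _ (extRep 2 vectorRep g (wedge 2 v) ⊗ₜ spinRep g φ) =
      extRep 3 spinRep g (TensorProduct.lift _ (wedge 2 v ⊗ₜ φ))
    rw [TensorProduct.lift.tmul, TensorProduct.lift.tmul, extRep_wedge, lift2_wedge, lift2_wedge]
    refine (opWedge3_equivariant g (fun ψ => ?_) φ).symm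
    simp only [Module.End.mul_apply, spinRep_starMul]

lemma twoFormsToTrivectors_tmul (v : Fin 2 → V9) (φ : Delta9) :
    twoFormsToTrivectors (wedge 2 v ⊗ₜ φ) = opWedge3 (starMul (v 0) * starMul (v 1)) φ :=
  (TensorProduct.lift.tmul _ _).trans (by rw [lift2_wedge])

/-- The map `v ↦ φ ↦ ∑ b, ∑ i, ε i ∧ e b ⋆ v ⋆ ε i ∧ e b ⋆ φ`. -/
def vectorLift : V9 →ₗ[ℝ] Delta9 →ₗ[ℝ] Ext 3 Delta9 :=
  ∑ b, LinearMap.lcomp ℝ _ (J b) ∘ₗ opWedge3 ∘ₗ LinearMap.mulLeft ℝ (J b) ∘ₗ starMul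

lemma vectorLift_apply (v : V9) (φ : Delta9) :
    vectorLift v φ = ∑ b, opWedge3 (J b * starMul v) (J b φ) := by
  simp [vectorLift]

/-- The sum over b is a contraction over an orthonormal basis of ℝ⁹, so `e b` may be replaced by its
image under the orthogonal map `vectorRep g`. -/
lemma vectorLift_equivariant (g : Spin9) (v : V9) (φ : Delta9) :
    vectorLift (vectorRep g v) (spinRep g φ) = extRep 3 spinRep g (vectorLift v φ) := by
  rw [vectorLift_apply, vectorLift_apply, map_sum]
  let C : V9 →ₗ[ℝ] V9 →ₗ[ℝ] Ext 3 Delta9 :=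
    (opWedge3 ∘ₗ LinearMap.mulRight ℝ (starMul (vectorRep g v)) ∘ₗ starMul).compl₂
      (starMul.flip (spinRep g φ))
  have h := sum_bilin_isometry (EuclideanSpace.basisFun (Fin 9) ℝ) C (vectorRep g)
    (inner_vectorRep g)
  have hC : ∀ x y, C x y =
      opWedge3 (starMul x * starMul (vectorRep g v)) (starMul y (spinRep g φ)) := fun _ _ => rfl
  simp only [hC, EuclideanSpace.basisFun_apply] at h
  refine h.symm.trans (Finset.sum_congr rfl fun b _ => ?_)
  rw [spinRep_starMul]
  refine (opWedge3_equivariant g (fun ψ => ?_) _).symm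
  rw [Module.End.mul_apply, Module.End.mul_apply, spinRep_starMul, spinRep_starMul]
  rfl

/-- The map `v ⊗ φ ↦ ∑ b, ∑ i, ε i ∧ e b ⋆ v ⋆ ε i ∧ e b ⋆ φ`. -/
def oneFormsLift : Ext 1 V9 →ₗ[ℝ] Delta9 →ₗ[ℝ] Ext 3 Delta9 :=
  exteriorPower.alternatingMapLinearEquiv
    (AlternatingMap.ofSubsingleton ℝ V9 (Delta9 →ₗ[ℝ] Ext 3 Delta9) (0 : Fin 1) vectorLift)

lemma oneFormsLift_wedge (v : Fin 1 → V9) : oneFormsLift (wedge 1 v) = vectorLift (v 0) := by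
  refine (exteriorPower.alternatingMapLinearEquiv_apply_ιMulti _ _).trans ?_
  rw [AlternatingMap.ofSubsingleton_apply_apply]

/-- The map `v ⊗ φ ↦ ∑ b, ∑ i, ε i ∧ e b ⋆ v ⋆ ε i ∧ e b ⋆ φ` as an intertwining map. -/
def oneFormsToTrivectors : (formRep 1).IntertwiningMap (extRep 3 spinRep) where
  toLinearMap := TensorProduct.lift oneFormsLift
  isIntertwining' g := by
    refine TensorProduct.ext ?_
    refine ext_wedge fun v => ?_
    ext1 φ
    change TensorProduct.lift _ (extRep 1 vectorRep g (wedge 1 v) ⊗ₜ spinRep g φ) =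
      extRep 3 spinRep g (TensorProduct.lift _ (wedge 1 v ⊗ₜ φ))
    rw [TensorProduct.lift.tmul, TensorProduct.lift.tmul, extRep_wedge, oneFormsLift_wedge,
      oneFormsLift_wedge, vectorLift_equivariant]

lemma oneFormsToTrivectors_tmul (v : Fin 1 → V9) (φ : Delta9) :
    oneFormsToTrivectors (wedge 1 v ⊗ₜ φ) = vectorLift (v 0) φ :=
  (TensorProduct.lift.tmul _ _).trans (by rw [oneFormsLift_wedge])

end IntertwiningMaps

/-! ### Explicit coordinates showing that the maps are nonzero. -/

section Nonvanishing

/-- The coordinates of a spinor with the given indices. -/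
def spinorCoords {k : ℕ} (s : Fin k → SpinorIndex) : Delta9 →ₗ[ℝ] Fin k → ℝ :=
  LinearMap.pi fun j => (EuclideanSpace.proj (s j)).toLinearMap

lemma spinorCoords_apply {k : ℕ} (s : Fin k → SpinorIndex) (φ : Delta9) (j : Fin k) :
    spinorCoords s φ j = φ (s j) := rfl

lemma spinorBasis_apply (i j : SpinorIndex) : spinorBasis i j = if j = i then (1 : ℝ) else 0 := by
  simp

lemma toEuclideanLin_spinorBasis (M : Matrix SpinorIndex SpinorIndex ℝ) (i j : SpinorIndex) :
    Matrix.toEuclideanLin M (spinorBasis i) j = M j i := by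
  simp [Matrix.toLpLin_apply]

lemma detForm_opWedge2 (M : Matrix SpinorIndex SpinorIndex ℝ) (s t : SpinorIndex) :
    detForm 2 (spinorCoords ![s, t]) (opWedge2 (Matrix.toEuclideanLin M)) = M t s - M s t := by
  simp only [opWedge2_apply, map_sum, wedge2_apply, detForm_wedge, Matrix.det_fin_two,
    Matrix.of_apply, spinorCoords_apply, Matrix.cons_val_zero, Matrix.cons_val_one,
    toEuclideanLin_spinorBasis, spinorBasis_apply]
  simp [Finset.sum_sub_distrib]

lemma detForm_opWedge3 (M : Matrix SpinorIndex SpinorIndex ℝ) (φ : Delta9)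
    (s t w : SpinorIndex) :
    detForm 3 (spinorCoords ![s, t, w]) (opWedge3 (Matrix.toEuclideanLin M) φ) =
      (M t s - M s t) * φ w + (M w t - M t w) * φ s + (M s w - M w s) * φ t := by
  simp only [opWedge3_apply, map_sum, wedge3_apply, detForm_wedge, Matrix.det_fin_three,
    Matrix.of_apply, spinorCoords_apply, Matrix.cons_val,
    toEuclideanLin_spinorBasis, spinorBasis_apply]
  simp only [Finset.sum_sub_distrib, Finset.sum_add_distrib, ite_mul, one_mul, zero_mul,
    Finset.sum_ite_eq, Finset.mem_univ, if_true]
  ring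

lemma J_mul_J (a b : Fin 9) : J a * J b = Matrix.toEuclideanLin (I a * I b) := by
  rw [J_eq, J_eq, Module.End.mul_eq_comp, ← Matrix.toLpLin_mul_same]

lemma J_mul_J_mul_J (a b c : Fin 9) :
    J a * (J b * J c) = Matrix.toEuclideanLin (I a * (I b * I c)) := by
  rw [J_mul_J b c, J_eq, Module.End.mul_eq_comp, ← Matrix.toLpLin_mul_same]

lemma twoFormsToBivectors_ne_zero : ∃ x, twoFormsToBivectors x ≠ 0 := by
  -- `I 7 * I 8` is σE ⊗ 1 ⊗ 1 ⊗ 1, which has an antisymmetric entry at the two chosen indices.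
  refine ⟨wedge 2 ![e 7, e 8], fun h => ?_⟩
  have h1 := congrArg (detForm 2 (spinorCoords ![(0, 0, 0, 0), (1, 0, 0, 0)])) h
  rw [twoFormsToBivectors_wedge, map_zero] at h1
  simp only [Matrix.cons_val] at h1
  rw [J_mul_J, detForm_opWedge2] at h1
  simp [I, ← Matrix.mul_kronecker_mul, σX, σZ] at h1

lemma threeFormsToBivectors_e (a b c : Fin 9) :
    threeFormsToBivectors (wedge 3 ![e a, e b, e c]) =
      opWedge2 (Matrix.toEuclideanLin (I a * (I b * I c))) :=
  (threeFormsToBivectors_wedge _).trans (congrArg opWedge2 (J_mul_J_mul_J a b c))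

lemma threeFormsToBivectors_ne_zero : ∃ x, threeFormsToBivectors x ≠ 0 := by
  -- `I 6 * (I 7 * I 8)` is -(1 ⊗ σE ⊗ σE ⊗ σE), which pairs the two chosen indices.
  refine ⟨wedge 3 ![e 6, e 7, e 8], fun h => ?_⟩
  have h1 := congrArg (detForm 2 (spinorCoords ![(0, 0, 0, 0), (0, 1, 1, 1)])) h
  rw [threeFormsToBivectors_e, detForm_opWedge2, map_zero] at h1
  simp [I, ← Matrix.mul_kronecker_mul, σX, σZ, σE] at h1
  norm_num at h1

/-- The coordinate of the trivector `opWedge3 M (M ε)` at three fixed spinor indices, where `ε` is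
the first basis spinor. -/
def trivectorCoord (M : Matrix SpinorIndex SpinorIndex ℝ) : ℝ :=
  (M (0, 1, 1, 0) (0, 0, 0, 1) - M (0, 0, 0, 1) (0, 1, 1, 0)) * M (0, 1, 1, 1) (0, 0, 0, 0) +
    (M (0, 1, 1, 1) (0, 1, 1, 0) - M (0, 1, 1, 0) (0, 1, 1, 1)) * M (0, 0, 0, 1) (0, 0, 0, 0) +
    (M (0, 0, 0, 1) (0, 1, 1, 1) - M (0, 1, 1, 1) (0, 0, 0, 1)) * M (0, 1, 1, 0) (0, 0, 0, 0)

/-- The coordinate form on trivectors used in `trivectorCoord`. -/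
def trivectorForm : Ext 3 Delta9 →ₗ[ℝ] ℝ :=
  detForm 3 (spinorCoords ![(0, 0, 0, 1), (0, 1, 1, 0), (0, 1, 1, 1)])

lemma trivectorForm_opWedge3 (a b : Fin 9) :
    trivectorForm (opWedge3 (J a * J b) (J a (J b (spinorBasis (0, 0, 0, 0))))) =
      trivectorCoord (I a * I b) := by
  rw [← Module.End.mul_apply, J_mul_J, trivectorForm, detForm_opWedge3]
  simp only [toEuclideanLin_spinorBasis]
  rfl

lemma trivectorForm_form2 (a b : Fin 9) :
    trivectorForm (twoFormsToTrivectors (form2 (e a) (e b) (spinorBasis (0, 0, 0, 0)))) =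
      trivectorCoord (I a * I b) := by
  rw [form2_apply, twoFormsToTrivectors_tmul]
  simp only [Matrix.cons_val]
  exact trivectorForm_opWedge3 a b

lemma trivectorForm_form1 (a : Fin 9) :
    trivectorForm (oneFormsToTrivectors (form1 (e a) (spinorBasis (0, 0, 0, 0)))) =
      ∑ b, trivectorCoord (I b * I a) := by
  rw [form1_apply, oneFormsToTrivectors_tmul, vectorLift_apply, map_sum]
  simp only [Matrix.cons_val_fin_one]
  exact Finset.sum_congr rfl fun b _ => trivectorForm_opWedge3 b a

lemma diff1_mem_P (a b : Fin 9) (ψ : Delta9) : diff1 a b ψ ∈ (P 1).toSubmodule := by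
  change thetaStar 0 (diff1 a b ψ) = 0
  rw [diff1_apply, map_sub, thetaStar_form1, thetaStar_form1, sub_self]

lemma diff2_mem_P {a b c d : Fin 9} (hac : a ≠ c) (had : a ≠ d) (hbc : b ≠ c) (hbd : b ≠ d)
    (ψ : Delta9) : diff2 a b c d ψ ∈ (P 2).toSubmodule := by
  change thetaStar 1 (diff2 a b c d ψ) = 0
  rw [diff2_apply, map_sub, map_sub, map_sub, thetaStar_form2 hac, thetaStar_form2 had,
    thetaStar_form2 hbc, thetaStar_form2 hbd]
  abel

-- Of the four edges only (7, 0) contributes: `I 7 * I 0` is σZ ⊗ σE ⊗ σX ⊗ 1, with coordinate -2,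
-- and the coordinates of the other three products vanish.
set_option maxHeartbeats 1000000 in
lemma twoFormsToTrivectors_diff2_ne_zero :
    twoFormsToTrivectors (diff2 7 8 0 1 (spinorBasis (0, 0, 0, 0))) ≠ 0 := by
  intro h
  have h1 := congrArg trivectorForm h
  rw [diff2_apply] at h1
  simp only [map_sub, trivectorForm_form2, map_zero] at h1
  simp [trivectorCoord, I, ← Matrix.mul_kronecker_mul, σX, σZ, σE] at h1
  norm_num at h1

-- The products `I b * I 8` contribute nothing. Among the `I b * I 7` only b = 0, 3, 6 do, each with
-- coordinate -2, so nothing cancels.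
set_option maxHeartbeats 1000000 in
lemma oneFormsToTrivectors_diff1_ne_zero :
    oneFormsToTrivectors (diff1 7 8 (spinorBasis (0, 0, 0, 0))) ≠ 0 := by
  intro h
  have h1 := congrArg trivectorForm h
  rw [diff1_apply] at h1
  simp only [map_sub, trivectorForm_form1, map_zero] at h1
  simp [Fin.sum_univ_succ, trivectorCoord, I, ← Matrix.mul_kronecker_mul, σX, σZ, σE] at h1
  norm_num at h1

end Nonvanishing

/-! ### Dimension counts and the two decompositions. -/

section Decompositions

instance finiteDimensional_ext {V : Type} [AddCommGroup V] [Module ℝ V] [FiniteDimensional ℝ V] (k : ℕ) :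
    FiniteDimensional ℝ (Ext k V) :=
  inferInstanceAs (Module.Finite ℝ (⋀[ℝ]^k V))

lemma finrank_ext {V : Type} [AddCommGroup V] [Module ℝ V] [FiniteDimensional ℝ V] (k : ℕ) :
    Module.finrank ℝ (Ext k V) = (Module.finrank ℝ V).choose k :=
  exteriorPower.finrank_eq ℝ k

lemma finrank_delta9 : Module.finrank ℝ Delta9 = 16 := by
  rw [finrank_euclideanSpace]
  rfl

lemma finrank_form (k : ℕ) : Module.finrank ℝ (Ext k V9 ⊗[ℝ] Delta9) = Nat.choose 9 k * 16 := by
  rw [Module.finrank_tensorProduct, finrank_ext, finrank_delta9, finrank_euclideanSpace,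
    Fintype.card_fin]

/-- Rank-nullity for Θ*, with the rank bounded by the dimension of the target; surjectivity of Θ* is
not needed. -/
lemma le_finrank_P (k : ℕ) :
    Nat.choose 9 (k + 1) * 16 ≤ Module.finrank ℝ (P (k + 1)).toSubmodule + Nat.choose 9 k * 16 := by
  rw [← finrank_form, ← finrank_form, ← (thetaStar k).finrank_range_add_finrank_ker, add_comm]
  exact Nat.add_le_add_left (Submodule.finrank_le _) _

instance : (P 1).toRepresentation.IsIrreducible := by
  refine toRepresentation_isIrreducible _ _ (fun h => ?_) fun _ => P_one_le
  have := le_finrank_P 0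
  rw [h] at this
  simp at this

instance : (P 2).toRepresentation.IsIrreducible := by
  refine toRepresentation_isIrreducible _ _ (fun h => ?_) fun _ => P_two_le
  have := le_finrank_P 1
  rw [h] at this
  simp [Nat.choose] at this

instance : (extRep 2 vectorRep).IsIrreducible := extRep_vectorRep_isIrreducible 2 (by norm_num)

instance : (extRep 3 vectorRep).IsIrreducible := extRep_vectorRep_isIrreducible 3 (by norm_num)

lemma nonempty_bivector_equiv :
    Nonempty ((extRep 2 spinRep).Equiv ((extRep 2 vectorRep).prod (extRep 3 vectorRep))) := by
  have h2 : Module.finrank ℝ (Ext 2 V9) = 36 := by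
    rw [finrank_ext, finrank_euclideanSpace]
    rfl
  have h3 : Module.finrank ℝ (Ext 3 V9) = 84 := by
    rw [finrank_ext, finrank_euclideanSpace]
    rfl
  have h : Module.finrank ℝ (Ext 2 Delta9) = 120 := by
    rw [finrank_ext, finrank_delta9]
    rfl
  refine nonempty_equiv_prod twoFormsToBivectors threeFormsToBivectors twoFormsToBivectors_ne_zero
    threeFormsToBivectors_ne_zero ?_ ?_ <;> omega

/-- The inclusion of a subrepresentation as an intertwining map. -/
def subtypeMap {G V : Type*} [Monoid G] [AddCommGroup V] [Module ℝ V] {ρ : Representation ℝ G V}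
    (S : Subrepresentation ρ) : S.toRepresentation.IntertwiningMap ρ where
  toLinearMap := S.toSubmodule.subtype
  isIntertwining' _ := rfl

lemma nonempty_trivector_equiv :
    Nonempty ((extRep 3 spinRep).Equiv ((P 1).toRepresentation.prod (P 2).toRepresentation)) := by
  have h1 := le_finrank_P 0
  have h2 := le_finrank_P 1
  have h3 : Module.finrank ℝ (P 1).toSubmodule ≤ 144 :=
    (Submodule.finrank_le _).trans (finrank_form 1).le
  have h : Module.finrank ℝ (Ext 3 Delta9) = 560 := by
    rw [finrank_ext, finrank_delta9]
    rfl
  simp only [zero_add, Nat.choose, Nat.reduceAdd] at h1 h2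
  -- 128 ≤ dim P₁ ≤ 144 < 432 ≤ dim P₂ gives unequal dimensions, and 128 + 432 = 560 is the
  -- dimension of Λ³(Δ₉).
  refine nonempty_equiv_prod (oneFormsToTrivectors.comp (subtypeMap (P 1)))
    (twoFormsToTrivectors.comp (subtypeMap (P 2)))
    ⟨⟨_, diff1_mem_P _ _ _⟩, oneFormsToTrivectors_diff1_ne_zero⟩
    ⟨⟨_, diff2_mem_P (by decide) (by decide) (by decide) (by decide) _⟩,
      twoFormsToTrivectors_diff2_ne_zero⟩ ?_ ?_ <;> omega

end Decompositions

end Spin9Rep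

end

theorem proposition1 :
    (Nonempty ((Spin9Rep.extRep 2 Spin9Rep.spinRep).Equiv
        ((Spin9Rep.extRep 2 Spin9Rep.vectorRep).prod (Spin9Rep.extRep 3 Spin9Rep.vectorRep))) ∧
      (Spin9Rep.extRep 2 Spin9Rep.vectorRep).IsIrreducible ∧
      (Spin9Rep.extRep 3 Spin9Rep.vectorRep).IsIrreducible) ∧
    (Nonempty ((Spin9Rep.extRep 3 Spin9Rep.spinRep).Equiv
        ((Spin9Rep.P 1).toRepresentation.prod (Spin9Rep.P 2).toRepresentation)) ∧
      (Spin9Rep.P 1).toRepresentation.IsIrreducible ∧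
      (Spin9Rep.P 2).toRepresentation.IsIrreducible) :=
  ⟨⟨Spin9Rep.nonempty_bivector_equiv, inferInstance, inferInstance⟩,
    Spin9Rep.nonempty_trivector_equiv, inferInstance, inferInstance⟩
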